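/- **Setting.** Write $\odot$ for $\otimes_{\mathbb C}$ and use Sweedler notation. Let $A$ be a CQG Hopf $*$-algebra, i.e. a complex Hopf algebra $(A,\Delta_A,\varepsilon_A,S_A)$ with an anti-linear involution satisfying $(ab)^*=b^*a^*$, $\Delta_A(a^*)=\Delta_A(a)^{*\otimes *}$, and admitting a linear functional $\Phi_A$ with $\Phi_A(1)=1$, $\Phi_A(a^*a)\ge 0$ and $(\Phi_A\otimes \mathrm{id})\Delta_A(a)=\Phi_A(a)1=(\mathrm{id}\otimes\Phi_A)\Delta_A(a)$. Put $a^\dagger=S_A(a)^*$. Let $(A,B,C)$ be a unitary Doi–Koppinen datum of coideal type, that is: * $B$ is a unital $*$-algebra with a right $A$-comodule structure $\alpha_B:B\to B\odot A$ that is a unital $*$-homomorphism; * $C$ is a left $A$-module coalgebra ($\Delta_C(ac)=\Delta_A(a)\Delta_C(c)$, $\varepsilon_C(ac)=\varepsilon_A(a)\varepsilon_C(c)$) with an anti-linear involution $\dagger$ satisfying $\Delta_C(c^\dagger)=\Delta_C^{\mathrm{op}}(c)^{\dagger\otimes\dagger}$ and $(ac)^\dagger=a^\dagger c^\dagger$;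 * there are given an injective unital $*$-homomorphism $B\hookrightarrow A$ intertwining $\alpha_B$ and $\Delta_A$, by which we regard $B\subseteq A$, and a surjective map $\pi:A\to C$ of coalgebras and of left $A$-modules with $\pi(a^\dagger)=\pi(a)^\dagger$ and $\ker\pi=AB_+$, where $B_+=B\cap\ker\varepsilon_A$. Let ${}_B\mathrm{Mod}^C$ be the category of Doi–Koppinen modules: left $B$-modules $V$ with a right $C$-comodule structure $\delta$ such that $\delta(bv)=\alpha_B(b)\delta(v)$. Let ${}_B\mathrm{Mod}^A_B$ be the category of $B$-bimodules $M$ with a right $A$-comodule structure $\delta$ such that $\delta(bm)=\alpha_B(b)\delta(m)$ and $\delta(mb)=\delta(m)\alpha_B(b)$. It has the tensor product $M\otimes_B N$, with the left $B$-module structure of $M$, the right $B$-module structure of $N$, and coaction $m\otimes n\mapsto m_{(0)}\otimes n_{(0)}\otimes m_{(1)}n_{(1)}$. Consider $$F:{}_B\mathrm{Mod}^C\to{}_B\mathrm{Mod}^A_B,\quad F(V)=V\,\square^C A=\{z\in V\odot A: (\delta\otimes\mathrm{id})z=(\mathrm{id}\otimes(\pi\otimes\mathrm{id})\Delta_A)z\},$$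 with $b(v\otimes a)=b_{(0)}v\otimes b_{(1)}a$, $(v\otimes a)b=v\otimes ab$ and coaction $\mathrm{id}\otimes\Delta_A$, and $$G:{}_B\mathrm{Mod}^A_B\to{}_B\mathrm{Mod}^C,\quad G(M)=M/MB_+,$$ with the induced left $B$-module structure and coaction $[m]\mapsto[m_{(0)}]\otimes\pi(m_{(1)})$ (these are the quasi-inverse functors of Takeuchi's equivalence). For $V,W\in{}_B\mathrm{Mod}^C$ put $V\boxtimes W:=G(F(V)\otimes_B F(W))$. Consider the following objects of ${}_B\mathrm{Mod}^C$: $B$, with left multiplication and $\delta(b)=b_{(0)}\otimes\pi(b_{(1)})$; $C$, with the restriction to $B$ of its $A$-module structure and $\delta=\Delta_C$; $A$, with left multiplication by $B$ and $\delta(a)=a_{(1)}\otimes\pi(a_{(2)})$; and the regular Doi–Koppinen module $B\odot C$, with $b(b'\otimes c)=bb'\otimes c$ and $\delta(b\otimes c)=b_{(0)}\otimes c_{(1)}\otimes b_{(1)}c_{(2)}$. **Proposition 3.2.** In ${}_B\mathrm{Mod}^C$ one has: 1. $B\odot C$ is isomorphic to $B\boxtimes C$; 2. $A$ is isomorphic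 to $C\boxtimes B$. -/

import Mathlib

open scoped TensorProduct ComplexOrder
open Coalgebra

noncomputable section

/-! ## CQG Hopf `*`-algebras -/

/-- A CQG Hopf `*`-algebra: a complex Hopf algebra with a compatible `*`-structure,
admitting an invariant state `Φ`. -/
class IsCQGHopfStarAlgebra (A : Type*) [Ring A] [StarRing A] [HopfAlgebra ℂ A] [StarModule ℂ A] :
    Prop where
  /-- `Δ(a*) = Δ(a)^{* ⊗ *}` -/
  comul_star : ∀ a : A, comul (R := ℂ) (star a) = star (comul (R := ℂ) a)
  /-- There is a positive unital functional `Φ` with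
  `(Φ ⊗ id)Δ(a) = Φ(a)1 = (id ⊗ Φ)Δ(a)`. -/
  exists_invariant_state : ∃ Φ : A →ₗ[ℂ] ℂ, Φ 1 = 1 ∧ (∀ a : A, 0 ≤ Φ (star a * a)) ∧
    (∀ a : A, TensorProduct.lid ℂ A (Φ.rTensor A (comul a)) = Φ a • (1 : A)) ∧
    (∀ a : A, TensorProduct.rid ℂ A (Φ.lTensor A (comul a)) = Φ a • (1 : A))

namespace DoiKoppinen

/-! ## Comodules and actions on tensor products -/

/-- `δ : V → V ⊗ C` is a (coassociative, counital) right `C`-comodule structure on `V`. -/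
structure IsCoaction {C V : Type*} [AddCommGroup C] [Module ℂ C] [Coalgebra ℂ C]
    [AddCommGroup V] [Module ℂ V] (δ : V →ₗ[ℂ] V ⊗[ℂ] C) : Prop where
  coassoc : ∀ v, TensorProduct.assoc ℂ V C C (δ.rTensor C (δ v)) = (comul (R := ℂ)).lTensor V (δ v)
  counit : ∀ v, TensorProduct.rid ℂ V ((counit (R := ℂ)).lTensor V (δ v)) = v

section TensorAct

variable {X Y M N : Type*} [AddCommGroup M] [Module ℂ M] [AddCommGroup N] [Module ℂ N]

/-- Factorwise action `(x ⊗ y) · (m ⊗ n) = xm ⊗ yn` of `X ⊗ Y` on `M ⊗ N`. -/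
def tensorAct [AddCommGroup X] [Module ℂ X] [AddCommGroup Y] [Module ℂ Y]
    (f : X →ₗ[ℂ] Module.End ℂ M) (g : Y →ₗ[ℂ] Module.End ℂ N) :
    X ⊗[ℂ] Y →ₗ[ℂ] Module.End ℂ (M ⊗[ℂ] N) :=
  TensorProduct.homTensorHomMap (RingHom.id ℂ) M N M N ∘ₗ TensorProduct.map f g

@[simp] lemma tensorAct_tmul [AddCommGroup X] [Module ℂ X] [AddCommGroup Y] [Module ℂ Y]
    (f : X →ₗ[ℂ] Module.End ℂ M) (g : Y →ₗ[ℂ] Module.End ℂ N) (x : X) (y : Y) (m : M) (n : N) :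
    tensorAct f g (x ⊗ₜ y) (m ⊗ₜ n) = f x m ⊗ₜ g y n := rfl

lemma tensorAct_one [Ring X] [Algebra ℂ X] [Ring Y] [Algebra ℂ Y]
    (f : X →ₐ[ℂ] Module.End ℂ M) (g : Y →ₐ[ℂ] Module.End ℂ N) :
    tensorAct f.toLinearMap g.toLinearMap 1 = 1 := by
  ext m n
  simp [Algebra.TensorProduct.one_def]

lemma tensorAct_mul [Ring X] [Algebra ℂ X] [Ring Y] [Algebra ℂ Y]
    (f : X →ₐ[ℂ] Module.End ℂ M) (g : Y →ₐ[ℂ] Module.End ℂ N) (s t : X ⊗[ℂ] Y) :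
    tensorAct f.toLinearMap g.toLinearMap (s * t) =
      tensorAct f.toLinearMap g.toLinearMap s * tensorAct f.toLinearMap g.toLinearMap t := by
  induction s with
  | zero => simp
  | add s₁ s₂ h₁ h₂ => simp only [add_mul, map_add, h₁, h₂]
  | tmul x y =>
    induction t with
    | zero => simp
    | add s₁ s₂ h₁ h₂ => simp only [mul_add, map_add, h₁, h₂]
    | tmul x' y' =>
      ext m n
      simp

/-- The factorwise action of `X ⊗ Y` on `M ⊗ N`, as an algebra homomorphism. -/
def tensorActHom [Ring X] [Algebra ℂ X] [Ring Y] [Algebra ℂ Y]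
    (f : X →ₐ[ℂ] Module.End ℂ M) (g : Y →ₐ[ℂ] Module.End ℂ N) :
    X ⊗[ℂ] Y →ₐ[ℂ] Module.End ℂ (M ⊗[ℂ] N) :=
  AlgHom.ofLinearMap (tensorAct f.toLinearMap g.toLinearMap) (tensorAct_one f g) (tensorAct_mul f g)

end TensorAct

/-! ## Doi-Koppinen data -/

/-- The algebraic part of a Doi-Koppinen datum `(A, B, C)`: a right `A`-comodule algebra
structure `α` on `B` and a left `A`-module coalgebra structure `mod` on `C`. -/
structure Datum (A B C : Type*) [Ring A] [HopfAlgebra ℂ A] [Ring B] [Algebra ℂ B]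
    [AddCommGroup C] [Module ℂ C] [Coalgebra ℂ C] where
  /-- the coaction `α_B : B → B ⊗ A`, an algebra homomorphism -/
  α : B →ₐ[ℂ] B ⊗[ℂ] A
  isCoaction : IsCoaction α.toLinearMap
  /-- the left `A`-module structure of `C` -/
  mod : A →ₐ[ℂ] Module.End ℂ C
  comul_mod : ∀ a c, comul (R := ℂ) (mod a c) =
    tensorAct mod.toLinearMap mod.toLinearMap (comul a) (comul c)
  counit_mod : ∀ a c, counit (R := ℂ) (mod a c) = counit (R := ℂ) a * counit (R := ℂ) c

/-- A unitary Doi-Koppinen datum: `B` is a right `A`-comodule `*`-algebra and `C` is a left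
`A`-module `†`-coalgebra. Here `a† = S(a)*` on `A`. -/
structure UnitaryDatum (A B C : Type*) [Ring A] [StarRing A] [HopfAlgebra ℂ A] [StarModule ℂ A]
    [Ring B] [StarRing B] [Algebra ℂ B] [StarModule ℂ B]
    [AddCommGroup C] [Module ℂ C] [Coalgebra ℂ C] extends Datum A B C where
  α_star : ∀ b, α (star b) = star (α b)
  /-- the anti-linear involution `†` of `C` -/
  dag : C →ₗ⋆[ℂ] C
  dag_dag : ∀ c, dag (dag c) = c
  /-- `Δ(c†) = Δᵒᵖ(c)^{† ⊗ †}` -/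
  comul_dag : ∀ c, comul (R := ℂ) (dag c) =
    TensorProduct.map dag dag (TensorProduct.comm ℂ C C (comul c))
  dag_mod : ∀ a c, dag (mod a c) = mod (star (HopfAlgebra.antipode ℂ a)) (dag c)

/-- A unitary Doi-Koppinen datum of coideal type: moreover given are an equivariant embedding
`ι : B → A` of unital `*`-algebras and a quotient map `π : A → C` of `A`-module `†`-coalgebras
with kernel `A B₊`, where `B₊` is the kernel of the restriction of the counit of `A` to `B`. -/
structure CoidealDatum (A B C : Type*) [Ring A] [StarRing A] [HopfAlgebra ℂ A] [StarModule ℂ A]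
    [Ring B] [StarRing B] [Algebra ℂ B] [StarModule ℂ B]
    [AddCommGroup C] [Module ℂ C] [Coalgebra ℂ C] extends UnitaryDatum A B C where
  /-- the embedding of `B` in `A` -/
  ι : B →⋆ₐ[ℂ] A
  ι_injective : Function.Injective ι
  ι_equivariant : ∀ b, comul (R := ℂ) (ι b) = ι.toAlgHom.toLinearMap.rTensor A (α b)
  /-- the quotient map of `A` onto `C` -/
  π : A →ₗc[ℂ] C
  π_surjective : Function.Surjective π
  π_mod : ∀ a a', π (a * a') = mod a (π a')
  π_dag : ∀ a, π (star (HopfAlgebra.antipode ℂ a)) = dag (π a)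
  ker_π : LinearMap.ker π.toLinearMap =
    Submodule.span ℂ {x | ∃ (a : A) (b : B), counit (R := ℂ) (ι b) = 0 ∧ x = a * ι b}

variable {A B C : Type*} [Ring A] [HopfAlgebra ℂ A] [Ring B] [Algebra ℂ B]
  [AddCommGroup C] [Module ℂ C] [Coalgebra ℂ C]

/-- The algebraic Doi-Koppinen datum `(A, B, A)`, with `A` acting on itself by left
multiplication. -/
def Datum.self (D : Datum A B C) : Datum A B A where
  α := D.α
  isCoaction := D.isCoaction
  mod := Algebra.lmul ℂ A
  comul_mod a c := by
    have key : ∀ s t : A ⊗[ℂ] A, s * t = tensorAct (Algebra.lmul ℂ A).toLinearMap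
        (Algebra.lmul ℂ A).toLinearMap s t := by
      intro s t
      induction s with
      | zero => simp
      | add s₁ s₂ h₁ h₂ => simp only [add_mul, map_add, LinearMap.add_apply, h₁, h₂]
      | tmul x y =>
        induction t with
        | zero => simp
        | add s₁ s₂ h₁ h₂ => simp only [mul_add, map_add, h₁, h₂]
        | tmul x' y' => simp
    simp [key]
  counit_mod a c := by simp

/-! ## Doi-Koppinen modules -/

/-- An object of `_B Mod^C`: a left `B`-module with a right `C`-comodule structure such that
`δ(bv) = α(b) δ(v)`. For the datum `D.self`, this is an object of `_B Mod^A`. -/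
structure DKMod (D : Datum A B C) where
  carrier : Type*
  [addCommGroup : AddCommGroup carrier]
  [module : Module ℂ carrier]
  /-- the left `B`-module structure -/
  act : B →ₐ[ℂ] Module.End ℂ carrier
  /-- the right `C`-comodule structure -/
  coact : carrier →ₗ[ℂ] carrier ⊗[ℂ] C
  isCoaction : IsCoaction coact
  compat : ∀ b v, coact (act b v) =
    tensorAct act.toLinearMap D.mod.toLinearMap (D.α b) (coact v)

attribute [instance] DKMod.addCommGroup DKMod.module

/-- An isomorphism of Doi-Koppinen modules: a `B`-linear and `C`-colinear bijection. -/
structure DKMod.Iso {D : Datum A B C} (V W : DKMod D) where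
  toEquiv : V.carrier ≃ₗ[ℂ] W.carrier
  map_act : ∀ b v, toEquiv (V.act b v) = W.act b (toEquiv v)
  map_coact : ∀ v, W.coact (toEquiv v) = toEquiv.toLinearMap.rTensor C (V.coact v)

/-- The action induced on a quotient by a stable subspace. -/
def quotAct {R V : Type*} [Ring R] [Algebra ℂ R] [AddCommGroup V] [Module ℂ V]
    (f : R →ₐ[ℂ] Module.End ℂ V) (S : Submodule ℂ V) (h : ∀ b, S ≤ S.comap (f b)) :
    R →ₐ[ℂ] Module.End ℂ (V ⧸ S) :=
  AlgHom.ofLinearMap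
    { toFun := fun b => S.mapQ S (f b) (h b)
      map_add' := fun b b' => by ext v; simp
      map_smul' := fun r b => by ext v; simp }
    (by ext v; simp) (fun b b' => by ext v; simp)

@[simp] lemma quotAct_mk {R V : Type*} [Ring R] [Algebra ℂ R] [AddCommGroup V] [Module ℂ V]
    (f : R →ₐ[ℂ] Module.End ℂ V) (S : Submodule ℂ V) (h : ∀ b, S ≤ S.comap (f b)) (b : R) (v : V) :
    quotAct f S h b (S.mkQ v) = S.mkQ (f b v) := rfl

lemma tensorAct_quotAct {R R' V W : Type*} [Ring R] [Algebra ℂ R] [AddCommGroup V] [Module ℂ V]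
    [Ring R'] [Algebra ℂ R'] [AddCommGroup W] [Module ℂ W]
    (f : R →ₐ[ℂ] Module.End ℂ V) (S : Submodule ℂ V) (h : ∀ b, S ≤ S.comap (f b))
    (g : R' →ₗ[ℂ] Module.End ℂ W) (t : R ⊗[ℂ] R') (x : V ⊗[ℂ] W) :
    tensorAct (quotAct f S h).toLinearMap g t (S.mkQ.rTensor W x) =
      S.mkQ.rTensor W (tensorAct f.toLinearMap g t x) := by
  induction t with
  | zero => simp
  | add s₁ s₂ h₁ h₂ => simp only [map_add, LinearMap.add_apply, h₁, h₂]
  | tmul b a =>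
    induction x with
    | zero => simp
    | add x y hx hy => simp only [map_add, hx, hy]
    | tmul w c => rfl

/-- The quotient of a comodule by a subcomodule is a comodule. -/
lemma isCoaction_quot {V : Type*} [AddCommGroup V] [Module ℂ V] {δ : V →ₗ[ℂ] V ⊗[ℂ] C}
    (hδ : IsCoaction δ) (S : Submodule ℂ V) (hco : S ≤ LinearMap.ker (S.mkQ.rTensor C ∘ₗ δ)) :
    IsCoaction (S.liftQ (S.mkQ.rTensor C ∘ₗ δ) hco) := by
  constructor
  · intro v
    obtain ⟨v, rfl⟩ := S.mkQ_surjective v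
    have h := congrArg (S.mkQ.rTensor (C ⊗[ℂ] C)) (hδ.coassoc v)
    have h1 : ∀ x : V ⊗[ℂ] C, TensorProduct.assoc ℂ (V ⧸ S) C C
        ((S.liftQ (S.mkQ.rTensor C ∘ₗ δ) hco).rTensor C (S.mkQ.rTensor C x)) =
        S.mkQ.rTensor (C ⊗[ℂ] C) (TensorProduct.assoc ℂ V C C (δ.rTensor C x)) := by
      intro x
      induction x with
      | zero => simp
      | add x y hx hy => simp only [map_add, hx, hy]
      | tmul w c =>
        simp only [LinearMap.rTensor_tmul, Submodule.mkQ_apply, Submodule.liftQ_apply,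
          LinearMap.comp_apply]
        generalize δ w = y
        induction y with
        | zero => simp
        | add x y hx hy => simp only [map_add, TensorProduct.add_tmul, hx, hy]
        | tmul w c' => simp
    have h2 : ∀ x : V ⊗[ℂ] C, (comul (R := ℂ)).lTensor (V ⧸ S) (S.mkQ.rTensor C x) =
        S.mkQ.rTensor (C ⊗[ℂ] C) ((comul (R := ℂ)).lTensor V x) := by
      intro x
      induction x with
      | zero => simp
      | add x y hx hy => simp only [map_add, hx, hy]
      | tmul w c => simp
    have h3 : S.liftQ (S.mkQ.rTensor C ∘ₗ δ) hco (S.mkQ v) = S.mkQ.rTensor C (δ v) := by simp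
    rw [h3, h1, h2, h]
  · intro v
    obtain ⟨v, rfl⟩ := S.mkQ_surjective v
    have h := congrArg S.mkQ (hδ.counit v)
    have h1 : ∀ x : V ⊗[ℂ] C, TensorProduct.rid ℂ (V ⧸ S)
        ((counit (R := ℂ)).lTensor (V ⧸ S) (S.mkQ.rTensor C x)) =
        S.mkQ (TensorProduct.rid ℂ V ((counit (R := ℂ)).lTensor V x)) := by
      intro x
      induction x with
      | zero => simp
      | add x y hx hy => simp only [map_add, hx, hy]
      | tmul w c => simp
    have h3 : S.liftQ (S.mkQ.rTensor C ∘ₗ δ) hco (S.mkQ v) = S.mkQ.rTensor C (δ v) := by simp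
    rw [h3, h1, h]

/-- The quotient of a Doi-Koppinen module by a subspace `S` stable under `B` and the coaction. -/
def DKMod.quot {D : Datum A B C} (V : DKMod D) (S : Submodule ℂ V.carrier)
    (hact : ∀ b, S ≤ S.comap (V.act b))
    (hco : S ≤ LinearMap.ker (S.mkQ.rTensor C ∘ₗ V.coact)) : DKMod D where
  carrier := V.carrier ⧸ S
  act := quotAct V.act S hact
  coact := S.liftQ (S.mkQ.rTensor C ∘ₗ V.coact) hco
  isCoaction := isCoaction_quot V.isCoaction S hco
  compat b v := by
    obtain ⟨v, rfl⟩ := S.mkQ_surjective v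
    have h3 : ∀ v, S.liftQ (S.mkQ.rTensor C ∘ₗ V.coact) hco (S.mkQ v) =
        S.mkQ.rTensor C (V.coact v) := fun _ => rfl
    rw [quotAct_mk, h3, h3, V.compat, tensorAct_quotAct]

/-- The map `(m ⊗ a) ⊗ (n ⊗ c) ↦ (m ⊗ n) ⊗ ac`. -/
def mulCoact (D : Datum A B C) (M N : Type*) [AddCommGroup M] [Module ℂ M]
    [AddCommGroup N] [Module ℂ N] :
    (M ⊗[ℂ] A) ⊗[ℂ] (N ⊗[ℂ] C) →ₗ[ℂ] (M ⊗[ℂ] N) ⊗[ℂ] C :=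
  (TensorProduct.lift D.mod.toLinearMap).lTensor (M ⊗[ℂ] N) ∘ₗ
    (TensorProduct.tensorTensorTensorComm ℂ M A N C).toLinearMap

@[simp] lemma mulCoact_tmul (D : Datum A B C) {M N : Type*} [AddCommGroup M] [Module ℂ M]
    [AddCommGroup N] [Module ℂ N] (m : M) (a : A) (n : N) (c : C) :
    mulCoact D M N ((m ⊗ₜ a) ⊗ₜ (n ⊗ₜ c)) = (m ⊗ₜ n) ⊗ₜ D.mod a c := rfl

/-- The diagonal coaction `m ⊗ n ↦ m₍₀₎ ⊗ n₍₀₎ ⊗ m₍₁₎n₍₁₎` on the tensor product of an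
`A`-comodule and a `C`-comodule. -/
def diagCoact (D : Datum A B C) {M N : Type*} [AddCommGroup M] [Module ℂ M]
    [AddCommGroup N] [Module ℂ N] (δM : M →ₗ[ℂ] M ⊗[ℂ] A) (δN : N →ₗ[ℂ] N ⊗[ℂ] C) :
    M ⊗[ℂ] N →ₗ[ℂ] (M ⊗[ℂ] N) ⊗[ℂ] C :=
  mulCoact D M N ∘ₗ TensorProduct.map δM δN

/-- Auxiliary map `(m ⊗ a ⊗ a') ⊗ (n ⊗ c ⊗ c') ↦ (m ⊗ n) ⊗ ac ⊗ a'c'`. -/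
def mulCoact₂ (D : Datum A B C) (M N : Type*) [AddCommGroup M] [Module ℂ M]
    [AddCommGroup N] [Module ℂ N] :
    (M ⊗[ℂ] (A ⊗[ℂ] A)) ⊗[ℂ] (N ⊗[ℂ] (C ⊗[ℂ] C)) →ₗ[ℂ] (M ⊗[ℂ] N) ⊗[ℂ] (C ⊗[ℂ] C) :=
  (TensorProduct.lift (tensorAct D.mod.toLinearMap D.mod.toLinearMap)).lTensor (M ⊗[ℂ] N) ∘ₗ
    (TensorProduct.tensorTensorTensorComm ℂ M (A ⊗[ℂ] A) N (C ⊗[ℂ] C)).toLinearMap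

@[simp] lemma mulCoact₂_tmul (D : Datum A B C) {M N : Type*} [AddCommGroup M] [Module ℂ M]
    [AddCommGroup N] [Module ℂ N] (m : M) (a : A ⊗[ℂ] A) (n : N) (c : C ⊗[ℂ] C) :
    mulCoact₂ D M N ((m ⊗ₜ a) ⊗ₜ (n ⊗ₜ c)) =
      (m ⊗ₜ n) ⊗ₜ tensorAct D.mod.toLinearMap D.mod.toLinearMap a c := rfl

lemma isCoaction_diagCoact (D : Datum A B C) {M N : Type*} [AddCommGroup M] [Module ℂ M]
    [AddCommGroup N] [Module ℂ N] {δM : M →ₗ[ℂ] M ⊗[ℂ] A} {δN : N →ₗ[ℂ] N ⊗[ℂ] C}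
    (hM : IsCoaction δM) (hN : IsCoaction δN) : IsCoaction (diagCoact D δM δN) := by
  constructor
  · intro v
    induction v with
    | zero => simp
    | add x y hx hy => simp only [map_add, hx, hy]
    | tmul m n =>
      have h1 : ∀ (x : M ⊗[ℂ] A) (y : N ⊗[ℂ] C), TensorProduct.assoc ℂ (M ⊗[ℂ] N) C C
          ((diagCoact D δM δN).rTensor C (mulCoact D M N (x ⊗ₜ y))) =
          mulCoact₂ D M N (TensorProduct.assoc ℂ M A A (δM.rTensor A x) ⊗ₜ
            TensorProduct.assoc ℂ N C C (δN.rTensor C y)) := by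
        intro x y
        induction x with
        | zero => simp
        | add x x' hx hy => simp only [map_add, TensorProduct.add_tmul, hx, hy]
        | tmul m a =>
          induction y with
          | zero => simp
          | add x x' hx hy => simp only [map_add, TensorProduct.tmul_add, hx, hy]
          | tmul n c =>
            simp only [mulCoact_tmul, LinearMap.rTensor_tmul, diagCoact, LinearMap.comp_apply,
              TensorProduct.map_tmul]
            generalize δM m = u
            generalize δN n = w
            induction u with
            | zero => simp
            | add x x' hx hy => simp only [map_add, TensorProduct.add_tmul, hx, hy]
            | tmul m a =>
              induction w with
              | zero => simp
              | add x x' hx hy =>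
                simp only [map_add, TensorProduct.tmul_add, TensorProduct.add_tmul, hx, hy]
              | tmul n c => simp
      have h2 : ∀ (x : M ⊗[ℂ] A) (y : N ⊗[ℂ] C),
          (comul (R := ℂ)).lTensor (M ⊗[ℂ] N) (mulCoact D M N (x ⊗ₜ y)) =
          mulCoact₂ D M N ((comul (R := ℂ)).lTensor M x ⊗ₜ (comul (R := ℂ)).lTensor N y) := by
        intro x y
        induction x with
        | zero => simp
        | add x x' hx hy => simp only [map_add, TensorProduct.add_tmul, hx, hy]
        | tmul m a =>
          induction y with
          | zero => simp
          | add x x' hx hy => simp only [map_add, TensorProduct.tmul_add, hx, hy]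
          | tmul n c => simp [D.comul_mod]
      have h3 : diagCoact D δM δN (m ⊗ₜ n) = mulCoact D M N (δM m ⊗ₜ δN n) := rfl
      rw [h3, h1, h2, hM.coassoc, hN.coassoc]
  · intro v
    induction v with
    | zero => simp
    | add x y hx hy => simp only [map_add, hx, hy]
    | tmul m n =>
      have h1 : ∀ (x : M ⊗[ℂ] A) (y : N ⊗[ℂ] C), TensorProduct.rid ℂ (M ⊗[ℂ] N)
          ((counit (R := ℂ)).lTensor (M ⊗[ℂ] N) (mulCoact D M N (x ⊗ₜ y))) =
          TensorProduct.rid ℂ M ((counit (R := ℂ)).lTensor M x) ⊗ₜ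
            TensorProduct.rid ℂ N ((counit (R := ℂ)).lTensor N y) := by
        intro x y
        induction x with
        | zero => simp
        | add x x' hx hy => simp only [map_add, TensorProduct.add_tmul, hx, hy]
        | tmul m a =>
          induction y with
          | zero => simp
          | add x x' hx hy => simp only [map_add, TensorProduct.tmul_add, hx, hy]
          | tmul n c =>
            simp [D.counit_mod, TensorProduct.smul_tmul', TensorProduct.tmul_smul, smul_smul,
              mul_comm]
      have h3 : diagCoact D δM δN (m ⊗ₜ n) = mulCoact D M N (δM m ⊗ₜ δN n) := rfl
      rw [h3, h1, hM.counit, hN.counit]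

/-- The left `B`-module structure `b(m ⊗ n) = bm ⊗ n`. -/
def actLeft {R M : Type*} [Ring R] [Algebra ℂ R] [AddCommGroup M] [Module ℂ M]
    (f : R →ₐ[ℂ] Module.End ℂ M) (N : Type*) [AddCommGroup N] [Module ℂ N] :
    R →ₐ[ℂ] Module.End ℂ (M ⊗[ℂ] N) :=
  (tensorActHom f (AlgHom.id ℂ (Module.End ℂ N))).comp Algebra.TensorProduct.includeLeft

@[simp] lemma actLeft_tmul {R M N : Type*} [Ring R] [Algebra ℂ R] [AddCommGroup M] [Module ℂ M]
    [AddCommGroup N] [Module ℂ N] (f : R →ₐ[ℂ] Module.End ℂ M) (r : R) (m : M) (n : N) :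
    actLeft f N r (m ⊗ₜ n) = f r m ⊗ₜ n := rfl

/-- The action `r(m ⊗ n) = m ⊗ rn`. -/
def actRight (M : Type*) {R N : Type*} [Ring R] [Algebra ℂ R] [AddCommGroup M] [Module ℂ M]
    [AddCommGroup N] [Module ℂ N] (f : R →ₐ[ℂ] Module.End ℂ N) :
    R →ₐ[ℂ] Module.End ℂ (M ⊗[ℂ] N) :=
  (tensorActHom (AlgHom.id ℂ (Module.End ℂ M)) f).comp Algebra.TensorProduct.includeRight

@[simp] lemma actRight_tmul {R M N : Type*} [Ring R] [Algebra ℂ R] [AddCommGroup M] [Module ℂ M]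
    [AddCommGroup N] [Module ℂ N] (f : R →ₐ[ℂ] Module.End ℂ N) (r : R) (m : M) (n : N) :
    actRight M f r (m ⊗ₜ n) = m ⊗ₜ f r n := rfl

/-- The induction `V ⊗ W ∈ _B Mod^C` of a right `C`-comodule `W`, for `V ∈ _B Mod^A`: the
module structure is `b(v ⊗ w) = bv ⊗ w` and the comodule structure is
`v ⊗ w ↦ v₍₀₎ ⊗ w₍₀₎ ⊗ v₍₁₎w₍₁₎`. -/
def DKMod.ind {D : Datum A B C} (V : DKMod D.self) {W : Type*} [AddCommGroup W] [Module ℂ W]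
    (δ : W →ₗ[ℂ] W ⊗[ℂ] C) (hδ : IsCoaction δ) : DKMod D where
  carrier := V.carrier ⊗[ℂ] W
  act := actLeft V.act W
  coact := diagCoact D V.coact δ
  isCoaction := isCoaction_diagCoact D V.isCoaction hδ
  compat b x := by
    induction x with
    | zero => simp
    | add x y hx hy => simp only [map_add, hx, hy]
    | tmul v w =>
      have h1 : ∀ (t : B ⊗[ℂ] A) (x : V.carrier ⊗[ℂ] A) (y : W ⊗[ℂ] C),
          mulCoact D V.carrier W
            (tensorAct V.act.toLinearMap (Algebra.lmul ℂ A).toLinearMap t x ⊗ₜ y) =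
          tensorAct (actLeft V.act W).toLinearMap D.mod.toLinearMap t
            (mulCoact D V.carrier W (x ⊗ₜ y)) := by
        intro t x y
        induction t with
        | zero => simp
        | add s₁ s₂ h₁ h₂ =>
          simp only [map_add, LinearMap.add_apply, TensorProduct.add_tmul, h₁, h₂]
        | tmul b a =>
          induction x with
          | zero => simp
          | add x x' hx hy => simp only [map_add, TensorProduct.add_tmul, hx, hy]
          | tmul m a =>
            induction y with
            | zero => simp
            | add x x' hx hy => simp only [map_add, TensorProduct.tmul_add, hx, hy]
            | tmul n c => simp
      have h3 : ∀ v w, diagCoact D V.coact δ (v ⊗ₜ w) =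
        mulCoact D V.carrier W (V.coact v ⊗ₜ δ w) := fun _ _ => rfl
      rw [actLeft_tmul, h3, h3, V.compat]
      exact h1 _ _ _

/-! ## The category `_B Mod^A_B` -/

/-- The factorwise right action of `B ⊗ A` on `M ⊗ A`, for a right `B`-module `M`
(a left `Bᵐᵒᵖ`-module), with `A` acting on itself by right multiplication. -/
def tensorRAct {M : Type*} [AddCommGroup M] [Module ℂ M] (r : Bᵐᵒᵖ →ₐ[ℂ] Module.End ℂ M) :
    B ⊗[ℂ] A →ₗ[ℂ] Module.End ℂ (M ⊗[ℂ] A) :=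
  tensorAct (r.toLinearMap ∘ₗ (MulOpposite.opLinearEquiv ℂ).toLinearMap) (LinearMap.mul ℂ A).flip

@[simp] lemma tensorRAct_tmul {M : Type*} [AddCommGroup M] [Module ℂ M]
    (r : Bᵐᵒᵖ →ₐ[ℂ] Module.End ℂ M) (b : B) (a : A) (m : M) (a' : A) :
    tensorRAct r (b ⊗ₜ a) (m ⊗ₜ a') = r (MulOpposite.op b) m ⊗ₜ (a' * a) := rfl

/-- An object of `_B Mod^A_B`: a `B`-bimodule with a right `A`-comodule structure such that
`δ(bm) = α(b) δ(m)` and `δ(mb) = δ(m) α(b)`. -/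
structure RelHopfBimod (D : Datum A B C) extends DKMod D.self where
  /-- the right `B`-module structure -/
  ract : Bᵐᵒᵖ →ₐ[ℂ] Module.End ℂ carrier
  act_ract : ∀ b b' m, act b (ract b' m) = ract b' (act b m)
  compat_right : ∀ b m, coact (ract (MulOpposite.op b) m) = tensorRAct ract (D.α b) (coact m)

/-- The kernel of `M ⊗ N → M ⊗_B N`, spanned by the `mb ⊗ n - m ⊗ bn`. -/
def balancedKer {D : Datum A B C} (M N : RelHopfBimod D) :
    Submodule ℂ (M.carrier ⊗[ℂ] N.carrier) :=
  Submodule.span ℂ {x | ∃ (m : M.carrier) (b : B) (n : N.carrier),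
    x = M.ract (MulOpposite.op b) m ⊗ₜ n - m ⊗ₜ N.act b n}

lemma balancedKer_stable_left {D : Datum A B C} (M N : RelHopfBimod D) (b : B) :
    balancedKer M N ≤ (balancedKer M N).comap (actLeft M.act N.carrier b) := by
  refine Submodule.span_le.2 ?_
  rintro _ ⟨m, b', n, rfl⟩
  refine Submodule.subset_span ⟨M.act b m, b', n, ?_⟩
  simp [M.act_ract]

lemma balancedKer_stable_right {D : Datum A B C} (M N : RelHopfBimod D) (b : Bᵐᵒᵖ) :
    balancedKer M N ≤ (balancedKer M N).comap (actRight M.carrier N.ract b) := by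
  refine Submodule.span_le.2 ?_
  rintro _ ⟨m, b', n, rfl⟩
  refine Submodule.subset_span ⟨m, b', N.ract b n, ?_⟩
  simp [N.act_ract]

lemma balancedKer_stable_coact {D : Datum A B C} (M N : RelHopfBimod D) :
    balancedKer M N ≤ LinearMap.ker
      ((balancedKer M N).mkQ.rTensor A ∘ₗ diagCoact D.self M.coact N.coact) := by
  refine Submodule.span_le.2 ?_
  rintro _ ⟨m, b, n, rfl⟩
  have h1 : ∀ (t : B ⊗[ℂ] A) (x : M.carrier ⊗[ℂ] A) (y : N.carrier ⊗[ℂ] A),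
      (balancedKer M N).mkQ.rTensor A
        (mulCoact D.self M.carrier N.carrier (tensorRAct M.ract t x ⊗ₜ y)) =
      (balancedKer M N).mkQ.rTensor A (mulCoact D.self M.carrier N.carrier
        (x ⊗ₜ tensorAct N.act.toLinearMap D.self.mod.toLinearMap t y)) := by
    intro t x y
    induction t with
    | zero => simp
    | add s₁ s₂ h₁ h₂ =>
      simp only [map_add, LinearMap.add_apply, TensorProduct.add_tmul, TensorProduct.tmul_add,
        h₁, h₂]
    | tmul b a =>
      induction x with
      | zero => simp
      | add x x' hx hy => simp only [map_add, TensorProduct.add_tmul, hx, hy]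
      | tmul m a' =>
        induction y with
        | zero => simp
        | add x x' hx hy => simp only [map_add, TensorProduct.tmul_add, hx, hy]
        | tmul n a'' =>
          have h2 : (balancedKer M N).mkQ (M.ract (MulOpposite.op b) m ⊗ₜ n) =
              (balancedKer M N).mkQ (m ⊗ₜ N.act b n) :=
            (Submodule.Quotient.eq _).2 (Submodule.subset_span ⟨m, b, n, rfl⟩)
          have h3 : ∀ a a' : A, D.self.mod a a' = a * a' := fun _ _ => rfl
          simp only [tensorRAct_tmul, tensorAct_tmul, mulCoact_tmul, LinearMap.rTensor_tmul, h2, h3,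
            AlgHom.toLinearMap_apply, mul_assoc]
  have h3 : ∀ v w, diagCoact D.self M.coact N.coact (v ⊗ₜ w) =
        mulCoact D.self M.carrier N.carrier (M.coact v ⊗ₜ N.coact w) := fun _ _ => rfl
  simp only [SetLike.mem_coe, LinearMap.mem_ker, LinearMap.comp_apply, map_sub, h3,
    M.compat_right, N.compat]
  rw [h1, sub_eq_zero]
  rfl

lemma tensorRAct_quotAct {V : Type*} [AddCommGroup V] [Module ℂ V]
    (f : Bᵐᵒᵖ →ₐ[ℂ] Module.End ℂ V) (S : Submodule ℂ V) (h : ∀ b, S ≤ S.comap (f b))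
    (t : B ⊗[ℂ] A) (x : V ⊗[ℂ] A) :
    tensorRAct (quotAct f S h) t (S.mkQ.rTensor A x) = S.mkQ.rTensor A (tensorRAct f t x) := by
  induction t with
  | zero => simp
  | add s₁ s₂ h₁ h₂ => simp only [map_add, LinearMap.add_apply, h₁, h₂]
  | tmul b a =>
    induction x with
    | zero => simp
    | add x y hx hy => simp only [map_add, hx, hy]
    | tmul w c => rfl

lemma quot_compat_right {V : Type*} [AddCommGroup V] [Module ℂ V] (δ : V →ₗ[ℂ] V ⊗[ℂ] A)
    (f : Bᵐᵒᵖ →ₐ[ℂ] Module.End ℂ V) (S : Submodule ℂ V) (h : ∀ b, S ≤ S.comap (f b))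
    (hco : S ≤ LinearMap.ker (S.mkQ.rTensor A ∘ₗ δ)) (b : B) (t : B ⊗[ℂ] A) (x : V)
    (hx : δ (f (MulOpposite.op b) x) = tensorRAct f t (δ x)) :
    S.liftQ (S.mkQ.rTensor A ∘ₗ δ) hco (quotAct f S h (MulOpposite.op b) (S.mkQ x)) =
      tensorRAct (quotAct f S h) t (S.liftQ (S.mkQ.rTensor A ∘ₗ δ) hco (S.mkQ x)) := by
  rw [quotAct_mk]
  change S.mkQ.rTensor A (δ _) = tensorRAct (quotAct f S h) t (S.mkQ.rTensor A (δ x))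
  rw [tensorRAct_quotAct, hx]

/-- The quotient of `M ∈ _B Mod^A_B` by a subspace stable under all the structure. -/
def RelHopfBimod.quot {D : Datum A B C} (M : RelHopfBimod D) (S : Submodule ℂ M.carrier)
    (hact : ∀ b, S ≤ S.comap (M.act b)) (hract : ∀ b, S ≤ S.comap (M.ract b))
    (hco : S ≤ LinearMap.ker (S.mkQ.rTensor A ∘ₗ M.coact)) : RelHopfBimod D where
  toDKMod := M.toDKMod.quot S hact hco
  ract := quotAct M.ract S hract
  act_ract b b' x := by
    obtain ⟨x, rfl⟩ := S.mkQ_surjective x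
    exact congrArg S.mkQ (M.act_ract b b' x)
  compat_right b x := by
    obtain ⟨x, rfl⟩ := S.mkQ_surjective x
    exact quot_compat_right _ _ _ hract hco b (D.α b) x (M.compat_right b x)

lemma actLeft_actRight {R R' M N : Type*} [Ring R] [Algebra ℂ R] [AddCommGroup M] [Module ℂ M]
    [Ring R'] [Algebra ℂ R'] [AddCommGroup N] [Module ℂ N]
    (f : R →ₐ[ℂ] Module.End ℂ M) (g : R' →ₐ[ℂ] Module.End ℂ N) (r : R) (r' : R') (x : M ⊗[ℂ] N) :
    actLeft f N r (actRight M g r' x) = actRight M g r' (actLeft f N r x) := by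
  induction x with
  | zero => simp
  | add x y hx hy => simp only [map_add, hx, hy]
  | tmul m n => rfl

lemma diagCoact_actRight {D : Datum A B C} (M N : RelHopfBimod D) (b : B)
    (x : M.carrier ⊗[ℂ] N.carrier) :
    diagCoact D.self M.coact N.coact (actRight M.carrier N.ract (MulOpposite.op b) x) =
      tensorRAct (actRight M.carrier N.ract) (D.α b) (diagCoact D.self M.coact N.coact x) := by
  have h1 : ∀ (t : B ⊗[ℂ] A) (x : M.carrier ⊗[ℂ] A) (y : N.carrier ⊗[ℂ] A),
      mulCoact D.self M.carrier N.carrier (x ⊗ₜ tensorRAct N.ract t y) =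
      tensorRAct (actRight M.carrier N.ract) t
        (mulCoact D.self M.carrier N.carrier (x ⊗ₜ y)) := by
    intro t x y
    induction t with
    | zero => simp
    | add s₁ s₂ h₁ h₂ =>
      simp only [map_add, LinearMap.add_apply, TensorProduct.tmul_add, h₁, h₂]
    | tmul b a =>
      induction x with
      | zero => simp
      | add x x' hx hy => simp only [map_add, TensorProduct.add_tmul, hx, hy]
      | tmul m a' =>
        induction y with
        | zero => simp
        | add x x' hx hy => simp only [map_add, TensorProduct.tmul_add, hx, hy]
        | tmul n a'' =>
          have h3 : ∀ a a' : A, D.self.mod a a' = a * a' := fun _ _ => rfl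
          simp [h3, mul_assoc]
  induction x with
  | zero => simp
  | add x y hx hy => simp only [map_add, hx, hy]
  | tmul m n =>
    have h3 : ∀ v w, diagCoact D.self M.coact N.coact (v ⊗ₜ w) =
      mulCoact D.self M.carrier N.carrier (M.coact v ⊗ₜ N.coact w) := fun _ _ => rfl
    rw [actRight_tmul, h3, h3, N.compat_right, h1]

/-- The tensor product `M ⊗ N` over `ℂ` in `_B Mod^A_B`: the left `B`-module structure is that
of `M`, the right one is that of `N`, and the comodule structure is
`m ⊗ n ↦ m₍₀₎ ⊗ n₍₀₎ ⊗ m₍₁₎n₍₁₎`. -/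
def RelHopfBimod.tensorC {D : Datum A B C} (M N : RelHopfBimod D) : RelHopfBimod D where
  toDKMod := DKMod.ind (D := D.self) M.toDKMod N.coact N.isCoaction
  ract := actRight M.carrier N.ract
  act_ract b b' x := actLeft_actRight M.act N.ract b b' x
  compat_right b x := diagCoact_actRight M N b x

/-- The tensor product `M ⊗_B N` in `_B Mod^A_B`, with the structure induced by `M ⊗ N`. -/
def RelHopfBimod.tensor {D : Datum A B C} (M N : RelHopfBimod D) : RelHopfBimod D :=
  (M.tensorC N).quot (balancedKer M N) (balancedKer_stable_left M N)
    (balancedKer_stable_right M N) (balancedKer_stable_coact M N)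

/-! ## Subobjects -/

/-- The action on a stable subspace. -/
def subAct {R V : Type*} [Ring R] [Algebra ℂ R] [AddCommGroup V] [Module ℂ V]
    (f : R →ₐ[ℂ] Module.End ℂ V) (S : Submodule ℂ V) (h : ∀ b, ∀ x ∈ S, f b x ∈ S) :
    R →ₐ[ℂ] Module.End ℂ S :=
  AlgHom.ofLinearMap
    { toFun := fun b => (f b).restrict (h b)
      map_add' := fun b b' => by ext v; simp
      map_smul' := fun r b => by ext v; simp }
    (by ext v; simp) (fun b b' => by ext v; simp)

@[simp] lemma coe_subAct {R V : Type*} [Ring R] [Algebra ℂ R] [AddCommGroup V] [Module ℂ V]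
    (f : R →ₐ[ℂ] Module.End ℂ V) (S : Submodule ℂ V) (h : ∀ b, ∀ x ∈ S, f b x ∈ S) (b : R)
    (v : S) : S.subtype (subAct f S h b v) = f b v := rfl

lemma rTensor_subtype_injective {V : Type*} [AddCommGroup V] [Module ℂ V] (S : Submodule ℂ V)
    (W : Type*) [AddCommGroup W] [Module ℂ W] : Function.Injective (S.subtype.rTensor W) :=
  Module.Flat.rTensor_preserves_injective_linearMap _ S.injective_subtype

/-- The coaction on a subspace `S` of `V` with `δ(S) ⊆ S ⊗ C`. -/
def subCoact {V : Type*} [AddCommGroup V] [Module ℂ V] (δ : V →ₗ[ℂ] V ⊗[ℂ] C)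
    (S : Submodule ℂ V) (h : ∀ x ∈ S, δ x ∈ LinearMap.range (S.subtype.rTensor C)) :
    S →ₗ[ℂ] S ⊗[ℂ] C :=
  LinearMap.codRestrictOfInjective (δ ∘ₗ S.subtype) (S.subtype.rTensor C)
    (rTensor_subtype_injective S C) (fun x => h x x.2)

/-- The defining property of the coaction on `S`: it is the restriction of `δ`. -/
lemma rTensor_subCoact {V : Type*} [AddCommGroup V] [Module ℂ V] (δ : V →ₗ[ℂ] V ⊗[ℂ] C)
    (S : Submodule ℂ V) (h : ∀ x ∈ S, δ x ∈ LinearMap.range (S.subtype.rTensor C)) (x : S) :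
    S.subtype.rTensor C (subCoact δ S h x) = δ x :=
  LinearMap.codRestrictOfInjective_comp_apply _ _ _ _ _

lemma isCoaction_subCoact {V : Type*} [AddCommGroup V] [Module ℂ V] {δ : V →ₗ[ℂ] V ⊗[ℂ] C}
    (hδ : IsCoaction δ) (S : Submodule ℂ V)
    (h : ∀ x ∈ S, δ x ∈ LinearMap.range (S.subtype.rTensor C)) :
    IsCoaction (subCoact δ S h) := by
  constructor
  · intro v
    apply rTensor_subtype_injective S (C ⊗[ℂ] C)
    have h1 : ∀ x : S ⊗[ℂ] C, S.subtype.rTensor (C ⊗[ℂ] C)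
        (TensorProduct.assoc ℂ S C C ((subCoact δ S h).rTensor C x)) =
        TensorProduct.assoc ℂ V C C (δ.rTensor C (S.subtype.rTensor C x)) := by
      intro x
      induction x with
      | zero => simp
      | add x y hx hy => simp only [map_add, hx, hy]
      | tmul w c =>
        simp only [LinearMap.rTensor_tmul]
        rw [Submodule.subtype_apply, ← rTensor_subCoact δ S h w]
        generalize subCoact δ S h w = y
        induction y with
        | zero => simp
        | add x y hx hy => simp only [map_add, TensorProduct.add_tmul, hx, hy]
        | tmul w c' => simp
    have h2 : ∀ x : S ⊗[ℂ] C, S.subtype.rTensor (C ⊗[ℂ] C)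
        ((CoalgebraStruct.comul (R := ℂ)).lTensor S x) =
        (CoalgebraStruct.comul (R := ℂ)).lTensor V (S.subtype.rTensor C x) := by
      intro x
      induction x with
      | zero => simp
      | add x y hx hy => simp only [map_add, hx, hy]
      | tmul w c => simp
    rw [h1, h2, rTensor_subCoact, hδ.coassoc]
  · intro v
    apply S.injective_subtype
    have h1 : ∀ x : S ⊗[ℂ] C, S.subtype (TensorProduct.rid ℂ S
        ((CoalgebraStruct.counit (R := ℂ)).lTensor S x)) =
        TensorProduct.rid ℂ V ((CoalgebraStruct.counit (R := ℂ)).lTensor V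
          (S.subtype.rTensor C x)) := by
      intro x
      induction x with
      | zero => simp
      | add x y hx hy => simp only [map_add, hx, hy]
      | tmul w c => simp
    rw [h1, rTensor_subCoact, hδ.counit]
    rfl

lemma tensorAct_subAct {R R' V W : Type*} [Ring R] [Algebra ℂ R] [AddCommGroup V] [Module ℂ V]
    [Ring R'] [Algebra ℂ R'] [AddCommGroup W] [Module ℂ W]
    (f : R →ₐ[ℂ] Module.End ℂ V) (S : Submodule ℂ V) (h : ∀ b, ∀ x ∈ S, f b x ∈ S)
    (g : R' →ₗ[ℂ] Module.End ℂ W) (t : R ⊗[ℂ] R') (x : S ⊗[ℂ] W) :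
    S.subtype.rTensor W (tensorAct (subAct f S h).toLinearMap g t x) =
      tensorAct f.toLinearMap g t (S.subtype.rTensor W x) := by
  induction t with
  | zero => simp
  | add s₁ s₂ h₁ h₂ => simp only [map_add, LinearMap.add_apply, h₁, h₂]
  | tmul b a =>
    induction x with
    | zero => simp
    | add x y hx hy => simp only [map_add, hx, hy]
    | tmul w c => rfl

lemma tensorRAct_subAct {V : Type*} [AddCommGroup V] [Module ℂ V]
    (f : Bᵐᵒᵖ →ₐ[ℂ] Module.End ℂ V) (S : Submodule ℂ V) (h : ∀ b, ∀ x ∈ S, f b x ∈ S)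
    (t : B ⊗[ℂ] A) (x : S ⊗[ℂ] A) :
    S.subtype.rTensor A (tensorRAct (subAct f S h) t x) =
      tensorRAct f t (S.subtype.rTensor A x) := by
  induction t with
  | zero => simp
  | add s₁ s₂ h₁ h₂ => simp only [map_add, LinearMap.add_apply, h₁, h₂]
  | tmul b a =>
    induction x with
    | zero => simp
    | add x y hx hy => simp only [map_add, hx, hy]
    | tmul w c => rfl

/-- The subobject of `M ∈ _B Mod^A_B` on a subspace stable under all the structure. -/
def RelHopfBimod.sub {D : Datum A B C} (M : RelHopfBimod D) (S : Submodule ℂ M.carrier)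
    (hact : ∀ b, ∀ x ∈ S, M.act b x ∈ S) (hract : ∀ b, ∀ x ∈ S, M.ract b x ∈ S)
    (hco : ∀ x ∈ S, M.coact x ∈ LinearMap.range (S.subtype.rTensor A)) : RelHopfBimod D where
  carrier := S
  act := subAct M.act S hact
  coact := subCoact M.coact S hco
  isCoaction := isCoaction_subCoact M.isCoaction S hco
  compat b x := by
    apply rTensor_subtype_injective S A
    rw [rTensor_subCoact, tensorAct_subAct, rTensor_subCoact]
    exact M.compat b x
  ract := subAct M.ract S hract
  act_ract b b' x := S.injective_subtype (M.act_ract b b' x)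
  compat_right b x := by
    apply rTensor_subtype_injective S A
    rw [rTensor_subCoact, tensorRAct_subAct, rTensor_subCoact]
    exact M.compat_right b x

/-! ## The functors `F` and `G` and the box tensor product -/

section Coideal

variable [StarRing A] [StarModule ℂ A] [StarRing B] [StarModule ℂ B] (D : CoidealDatum A B C)

/-- The right `B`-module structure of `A`, by multiplication. -/
def CoidealDatum.rmul : Bᵐᵒᵖ →ₐ[ℂ] Module.End ℂ A :=
  AlgHom.ofLinearMap ((LinearMap.mul ℂ A).flip ∘ₗ D.ι.toAlgHom.toLinearMap ∘ₗ
      (MulOpposite.opLinearEquiv ℂ).symm.toLinearMap)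
    (by ext a; simp) (fun b b' => by ext a; simp [mul_assoc])

@[simp] lemma CoidealDatum.rmul_apply (b : Bᵐᵒᵖ) (a : A) : D.rmul b a = a * D.ι b.unop := rfl

/-- The left `C`-comodule structure `a ↦ π(a₍₁₎) ⊗ a₍₂₎` of `A`. -/
def CoidealDatum.leftCoact : A →ₗ[ℂ] C ⊗[ℂ] A :=
  D.π.toLinearMap.rTensor A ∘ₗ CoalgebraStruct.comul (R := ℂ)

variable {D}

/-- The coaction `v ⊗ a ↦ v ⊗ a₍₁₎ ⊗ a₍₂₎` of `A` on `V ⊗ A`. -/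
def coactRight (V A : Type*) [AddCommGroup V] [Module ℂ V] [AddCommGroup A] [Module ℂ A]
    [Coalgebra ℂ A] : V ⊗[ℂ] A →ₗ[ℂ] (V ⊗[ℂ] A) ⊗[ℂ] A :=
  (TensorProduct.assoc ℂ V A A).symm.toLinearMap ∘ₗ (CoalgebraStruct.comul (R := ℂ)).lTensor V

lemma isCoaction_coactRight (V A : Type*) [AddCommGroup V] [Module ℂ V] [AddCommGroup A]
    [Module ℂ A] [Coalgebra ℂ A] : IsCoaction (coactRight V A) := by
  constructor
  · intro x
    induction x with
    | zero => simp
    | add x y hx hy => simp only [map_add, hx, hy]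
    | tmul v a =>
      have h1 : ∀ y : A ⊗[ℂ] A, TensorProduct.assoc ℂ (V ⊗[ℂ] A) A A
          ((coactRight V A).rTensor A ((TensorProduct.assoc ℂ V A A).symm (v ⊗ₜ y))) =
          (TensorProduct.assoc ℂ V A (A ⊗[ℂ] A)).symm (v ⊗ₜ TensorProduct.assoc ℂ A A A
            ((CoalgebraStruct.comul (R := ℂ)).rTensor A y)) := by
        intro y
        induction y with
        | zero => simp
        | add x y hx hy => simp only [map_add, TensorProduct.tmul_add, hx, hy]
        | tmul a a' =>
          simp only [coactRight, TensorProduct.assoc_symm_tmul, LinearMap.rTensor_tmul,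
            LinearMap.comp_apply, LinearMap.lTensor_tmul, LinearEquiv.coe_coe]
          generalize CoalgebraStruct.comul (R := ℂ) a = z
          induction z with
          | zero => simp
          | add x y hx hy =>
            simp only [map_add, TensorProduct.tmul_add, TensorProduct.add_tmul, hx, hy]
          | tmul b b' => simp
      have h2 : ∀ y : A ⊗[ℂ] A, (CoalgebraStruct.comul (R := ℂ)).lTensor (V ⊗[ℂ] A)
          ((TensorProduct.assoc ℂ V A A).symm (v ⊗ₜ y)) =
          (TensorProduct.assoc ℂ V A (A ⊗[ℂ] A)).symm
            (v ⊗ₜ (CoalgebraStruct.comul (R := ℂ)).lTensor A y) := by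
        intro y
        induction y with
        | zero => simp
        | add x y hx hy => simp only [map_add, TensorProduct.tmul_add, hx, hy]
        | tmul a a' => simp
      have h3 : coactRight V A (v ⊗ₜ a) =
        (TensorProduct.assoc ℂ V A A).symm (v ⊗ₜ CoalgebraStruct.comul (R := ℂ) a) := rfl
      rw [h3, h1, h2, Coalgebra.coassoc_apply]
  · intro x
    induction x with
    | zero => simp
    | add x y hx hy => simp only [map_add, hx, hy]
    | tmul v a =>
      have h1 : ∀ y : A ⊗[ℂ] A, TensorProduct.rid ℂ (V ⊗[ℂ] A)
          ((CoalgebraStruct.counit (R := ℂ)).lTensor (V ⊗[ℂ] A)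
            ((TensorProduct.assoc ℂ V A A).symm (v ⊗ₜ y))) =
          v ⊗ₜ TensorProduct.rid ℂ A ((CoalgebraStruct.counit (R := ℂ)).lTensor A y) := by
        intro y
        induction y with
        | zero => simp
        | add x y hx hy => simp only [map_add, TensorProduct.tmul_add, hx, hy]
        | tmul a a' => simp
      have h3 : coactRight V A (v ⊗ₜ a) =
        (TensorProduct.assoc ℂ V A A).symm (v ⊗ₜ CoalgebraStruct.comul (R := ℂ) a) := rfl
      rw [h3, h1, Coalgebra.lTensor_counit_comul]
      simp

/-- For `V ∈ _B Mod^C`, the object `V ⊗ A ∈ _B Mod^A_B` with the diagonal left `B`-module structure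
`b(v ⊗ a) = b₍₀₎v ⊗ b₍₁₎a`, the right `B`-module structure `(v ⊗ a)b = v ⊗ ab` and the comodule
structure `v ⊗ a ↦ v ⊗ a₍₁₎ ⊗ a₍₂₎`. -/
def DKMod.tensorA (V : DKMod D.toDatum) : RelHopfBimod D.toDatum where
  carrier := V.carrier ⊗[ℂ] A
  act := (tensorActHom V.act (Algebra.lmul ℂ A)).comp D.α
  coact := coactRight V.carrier A
  isCoaction := isCoaction_coactRight V.carrier A
  compat b x := by
    let T := tensorActHom V.act (Algebra.lmul ℂ A)
    let K : B ⊗[ℂ] (A ⊗[ℂ] A) →ₗ[ℂ] Module.End ℂ ((V.carrier ⊗[ℂ] A) ⊗[ℂ] A) :=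
      tensorAct T.toLinearMap (Algebra.lmul ℂ A).toLinearMap ∘ₗ
        (TensorProduct.assoc ℂ B A A).symm.toLinearMap
    have h0 : ∀ (b : B) (s : A ⊗[ℂ] A) (v : V.carrier) (r : A ⊗[ℂ] A),
        (TensorProduct.assoc ℂ V.carrier A A).symm (V.act b v ⊗ₜ (s * r)) =
        K (b ⊗ₜ s) ((TensorProduct.assoc ℂ V.carrier A A).symm (v ⊗ₜ r)) := by
      intro b s v r
      induction s with
      | zero => simp
      | add s₁ s₂ h₁ h₂ =>
        simp only [map_add, LinearMap.add_apply, add_mul, TensorProduct.tmul_add, h₁, h₂]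
      | tmul a₁ a₂ =>
        induction r with
        | zero => simp
        | add s₁ s₂ h₁ h₂ => simp only [map_add, mul_add, TensorProduct.tmul_add, h₁, h₂]
        | tmul a₃ a₄ =>
          rw [Algebra.TensorProduct.tmul_mul_tmul]
          rfl
    have h1 : ∀ (t : B ⊗[ℂ] A) (x : V.carrier ⊗[ℂ] A), coactRight V.carrier A (T t x) =
        K ((CoalgebraStruct.comul (R := ℂ)).lTensor B t) (coactRight V.carrier A x) := by
      intro t x
      induction t with
      | zero => simp
      | add s₁ s₂ h₁ h₂ => simp only [map_add, LinearMap.add_apply, h₁, h₂]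
      | tmul b a =>
        induction x with
        | zero => simp
        | add x y hx hy => simp only [map_add, hx, hy]
        | tmul v a' =>
          refine Eq.trans ?_ (h0 b (CoalgebraStruct.comul a) v (CoalgebraStruct.comul a'))
          rw [← Bialgebra.comul_mul]
          rfl
    have h2 : ∀ t : B ⊗[ℂ] A, tensorAct (T.comp D.α).toLinearMap (Algebra.lmul ℂ A).toLinearMap t =
        K (TensorProduct.assoc ℂ B A A (D.α.toLinearMap.rTensor A t)) := by
      intro t
      induction t with
      | zero => simp
      | add s₁ s₂ h₁ h₂ => simp only [map_add, h₁, h₂]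
      | tmul b a =>
        simp only [K, LinearMap.rTensor_tmul, LinearMap.comp_apply, LinearEquiv.coe_coe,
          LinearEquiv.symm_apply_apply]
        rfl
    refine (h1 _ _).trans ?_
    refine Eq.trans ?_ (congrArg (fun f => f (coactRight V.carrier A x)) (h2 (D.α b))).symm
    have h3 := D.isCoaction.coassoc b
    rw [AlgHom.toLinearMap_apply] at h3
    exact congrArg (fun y => K y (coactRight V.carrier A x)) h3.symm
  ract := actRight V.carrier D.rmul
  act_ract b b' x := by
    have h1 : ∀ t : B ⊗[ℂ] A, tensorActHom V.act (Algebra.lmul ℂ A) t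
        (actRight V.carrier D.rmul b' x) =
        actRight V.carrier D.rmul b' (tensorActHom V.act (Algebra.lmul ℂ A) t x) := by
      intro t
      induction t with
      | zero => simp
      | add s₁ s₂ h₁ h₂ => simp only [map_add, LinearMap.add_apply, h₁, h₂]
      | tmul b a =>
        induction x with
        | zero => simp
        | add x y hx hy => simp only [map_add, hx, hy]
        | tmul v a' =>
          refine congrArg (V.act b v ⊗ₜ[ℂ] ·) (?_ : a * (a' * D.ι b'.unop) = a * a' * D.ι b'.unop)
          rw [mul_assoc]
    exact h1 _
  compat_right b x := by
    have h0 : ∀ (t : B ⊗[ℂ] A) (v : V.carrier) (r : A ⊗[ℂ] A),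
        (TensorProduct.assoc ℂ V.carrier A A).symm
          (v ⊗ₜ (r * D.ι.toAlgHom.toLinearMap.rTensor A t)) =
        tensorRAct (actRight V.carrier D.rmul) t
          ((TensorProduct.assoc ℂ V.carrier A A).symm (v ⊗ₜ r)) := by
      intro t v r
      induction t with
      | zero => simp
      | add s₁ s₂ h₁ h₂ =>
        simp only [map_add, LinearMap.add_apply, mul_add, TensorProduct.tmul_add, h₁, h₂]
      | tmul b a =>
        induction r with
        | zero => simp
        | add s₁ s₂ h₁ h₂ => simp only [map_add, add_mul, TensorProduct.tmul_add, h₁, h₂]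
        | tmul a₃ a₄ =>
          simp only [LinearMap.rTensor_tmul, Algebra.TensorProduct.tmul_mul_tmul]
          rfl
    induction x with
    | zero => simp
    | add x y hx hy => simp only [map_add, hx, hy]
    | tmul v a =>
      refine Eq.trans ?_ (h0 (D.α b) v (CoalgebraStruct.comul a))
      rw [← D.ι_equivariant, ← Bialgebra.comul_mul]
      rfl

/-- The cotensor product `V □^C A`, as a subspace of `V ⊗ A`. -/
def DKMod.cotensor (V : DKMod D.toDatum) : Submodule ℂ (V.carrier ⊗[ℂ] A) :=
  LinearMap.eqLocus
    ((TensorProduct.assoc ℂ V.carrier C A).toLinearMap ∘ₗ V.coact.rTensor A)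
    (D.leftCoact.lTensor V.carrier)

lemma CoidealDatum.leftCoact_mul (D : CoidealDatum A B C) (a a' : A) : D.leftCoact (a * a') =
    tensorAct D.mod.toLinearMap (Algebra.lmul ℂ A).toLinearMap (CoalgebraStruct.comul a)
      (D.leftCoact a') := by
  have h : ∀ s t : A ⊗[ℂ] A, D.π.toLinearMap.rTensor A (s * t) =
      tensorAct D.mod.toLinearMap (Algebra.lmul ℂ A).toLinearMap s
        (D.π.toLinearMap.rTensor A t) := by
    intro s t
    induction s with
    | zero => simp
    | add s₁ s₂ h₁ h₂ => simp only [map_add, LinearMap.add_apply, add_mul, h₁, h₂]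
    | tmul a₁ a₂ =>
      induction t with
      | zero => simp
      | add s₁ s₂ h₁ h₂ => simp only [map_add, mul_add, h₁, h₂]
      | tmul a₃ a₄ =>
        rw [Algebra.TensorProduct.tmul_mul_tmul]
        exact congrArg (· ⊗ₜ[ℂ] (a₂ * a₄)) (D.π_mod a₁ a₃)
  simp only [CoidealDatum.leftCoact, LinearMap.comp_apply, Bialgebra.comul_mul, h]

lemma CoidealDatum.π_mul_ι (D : CoidealDatum A B C) (a : A) (b : B) :
    D.π (a * D.ι b) = CoalgebraStruct.counit (R := ℂ) (D.ι b) • D.π a := by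
  have h : a * D.ι (b - algebraMap ℂ B (CoalgebraStruct.counit (R := ℂ) (D.ι b))) ∈
      LinearMap.ker D.π.toLinearMap := by
    rw [D.ker_π]
    refine Submodule.subset_span ⟨a, _, ?_, rfl⟩
    simp [Algebra.algebraMap_eq_smul_one]
  rw [LinearMap.mem_ker] at h
  have h' : D.π (a * D.ι b) -
      CoalgebraStruct.counit (R := ℂ) (D.ι b) • D.π a = 0 := by
    rw [← h, Algebra.algebraMap_eq_smul_one]
    simp [mul_sub]
  exact sub_eq_zero.1 h'

lemma CoidealDatum.lid_counit_α (D : CoidealDatum A B C) (b : B) : TensorProduct.lid ℂ A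
    ((CoalgebraStruct.counit (R := ℂ) ∘ₗ D.ι.toAlgHom.toLinearMap).rTensor A (D.α b)) =
      D.ι b := by
  rw [LinearMap.rTensor_comp_apply, ← D.ι_equivariant, Coalgebra.rTensor_counit_comul]
  simp

lemma CoidealDatum.leftCoact_mul_ι (D : CoidealDatum A B C) (a : A) (b : B) :
    D.leftCoact (a * D.ι b) = (D.rmul (MulOpposite.op b)).lTensor C (D.leftCoact a) := by
  have h : ∀ (s : A ⊗[ℂ] A) (t : B ⊗[ℂ] A),
      D.π.toLinearMap.rTensor A (s * D.ι.toAlgHom.toLinearMap.rTensor A t) =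
      (LinearMap.mulRight ℂ (TensorProduct.lid ℂ A
        ((CoalgebraStruct.counit (R := ℂ) ∘ₗ D.ι.toAlgHom.toLinearMap).rTensor A t))).lTensor C
        (D.π.toLinearMap.rTensor A s) := by
    intro s t
    induction s with
    | zero => simp
    | add s₁ s₂ h₁ h₂ => simp only [map_add, add_mul, h₁, h₂]
    | tmul a₁ a₂ =>
      induction t with
      | zero => simp
      | add s₁ s₂ h₁ h₂ =>
        simp only [map_add, mul_add, h₁, h₂, LinearMap.rTensor_tmul, LinearMap.lTensor_tmul,
          LinearMap.mulRight_apply, TensorProduct.tmul_add]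
      | tmul b a₄ =>
        have := D.π_mul_ι a₁ b
        simp [this, TensorProduct.smul_tmul]
  simp only [CoidealDatum.leftCoact, LinearMap.comp_apply, Bialgebra.comul_mul]
  rw [D.ι_equivariant, h, D.lid_counit_α]
  rfl

lemma CoidealDatum.rTensor_leftCoact_comul (D : CoidealDatum A B C) (a : A) :
    D.leftCoact.rTensor A (CoalgebraStruct.comul (R := ℂ) a) =
      coactRight C A (D.leftCoact a) := by
  have h1 : ∀ s : A ⊗[ℂ] A, D.leftCoact.rTensor A s = (TensorProduct.assoc ℂ C A A).symm
      (D.π.toLinearMap.rTensor (A ⊗[ℂ] A) (TensorProduct.assoc ℂ A A A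
        ((CoalgebraStruct.comul (R := ℂ)).rTensor A s))) := by
    intro s
    induction s with
    | zero => simp
    | add s₁ s₂ h₁ h₂ => simp only [map_add, h₁, h₂]
    | tmul a a' =>
      simp only [CoidealDatum.leftCoact, LinearMap.rTensor_tmul, LinearMap.comp_apply]
      generalize CoalgebraStruct.comul (R := ℂ) a = t
      induction t with
      | zero => simp
      | add s₁ s₂ h₁ h₂ => simp only [map_add, TensorProduct.add_tmul, h₁, h₂]
      | tmul x y => rfl
  have h2 : ∀ s : A ⊗[ℂ] A, coactRight C A (D.π.toLinearMap.rTensor A s) =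
      (TensorProduct.assoc ℂ C A A).symm (D.π.toLinearMap.rTensor (A ⊗[ℂ] A)
        ((CoalgebraStruct.comul (R := ℂ)).lTensor A s)) := by
    intro s
    induction s with
    | zero => simp
    | add s₁ s₂ h₁ h₂ => simp only [map_add, h₁, h₂]
    | tmul a a' => rfl
  rw [h1, Coalgebra.coassoc_apply, ← h2]
  rfl

lemma DKMod.cotensor_act (V : DKMod D.toDatum) (b : B) :
    ∀ x ∈ V.cotensor, V.tensorA.act b x ∈ V.cotensor := by
  let P := (TensorProduct.assoc ℂ V.carrier C A).toLinearMap ∘ₗ V.coact.rTensor A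
  let Q := D.leftCoact.lTensor V.carrier
  let T := tensorActHom V.act (Algebra.lmul ℂ A)
  let K : B ⊗[ℂ] (A ⊗[ℂ] A) →ₗ[ℂ] Module.End ℂ (V.carrier ⊗[ℂ] (C ⊗[ℂ] A)) :=
    tensorAct V.act.toLinearMap (tensorAct D.mod.toLinearMap (Algebra.lmul ℂ A).toLinearMap)
  have h0 : ∀ (t : B ⊗[ℂ] A) (x : V.carrier ⊗[ℂ] C) (a a' : A),
      TensorProduct.assoc ℂ V.carrier C A
        (tensorAct V.act.toLinearMap D.mod.toLinearMap t x ⊗ₜ (a * a')) =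
      K (TensorProduct.assoc ℂ B A A (t ⊗ₜ a))
        (TensorProduct.assoc ℂ V.carrier C A (x ⊗ₜ a')) := by
    intro t x a a'
    induction t with
    | zero => simp
    | add s₁ s₂ h₁ h₂ =>
      simp only [map_add, LinearMap.add_apply, TensorProduct.add_tmul, h₁, h₂]
    | tmul b a₁ =>
      induction x with
      | zero => simp
      | add s₁ s₂ h₁ h₂ => simp only [map_add, TensorProduct.add_tmul, h₁, h₂]
      | tmul v c => rfl
  have hP : ∀ (t : B ⊗[ℂ] A) (x : V.carrier ⊗[ℂ] A), P (T t x) =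
      K (TensorProduct.assoc ℂ B A A (D.α.toLinearMap.rTensor A t)) (P x) := by
    intro t x
    induction t with
    | zero => simp
    | add s₁ s₂ h₁ h₂ => simp only [map_add, LinearMap.add_apply, h₁, h₂]
    | tmul b a =>
      induction x with
      | zero => simp
      | add x y hx hy => simp only [map_add, hx, hy]
      | tmul v a' =>
        refine Eq.trans ?_ (h0 (D.α b) (V.coact v) a a')
        rw [← V.compat]
        rfl
  have hQ : ∀ (t : B ⊗[ℂ] A) (x : V.carrier ⊗[ℂ] A), Q (T t x) =
      K ((CoalgebraStruct.comul (R := ℂ)).lTensor B t) (Q x) := by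
    intro t x
    induction t with
    | zero => simp
    | add s₁ s₂ h₁ h₂ => simp only [map_add, LinearMap.add_apply, h₁, h₂]
    | tmul b a =>
      induction x with
      | zero => simp
      | add x y hx hy => simp only [map_add, hx, hy]
      | tmul v a' => exact congrArg (V.act b v ⊗ₜ[ℂ] ·) (D.leftCoact_mul a a')
  intro x hx
  have hx' : P x = Q x := hx
  have h3 := D.isCoaction.coassoc b
  rw [AlgHom.toLinearMap_apply] at h3
  change P (T (D.α b) x) = Q (T (D.α b) x)
  rw [hP, hQ, hx', h3]

lemma DKMod.cotensor_ract (V : DKMod D.toDatum) (b : Bᵐᵒᵖ) :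
    ∀ x ∈ V.cotensor, V.tensorA.ract b x ∈ V.cotensor := by
  let P := (TensorProduct.assoc ℂ V.carrier C A).toLinearMap ∘ₗ V.coact.rTensor A
  let Q := D.leftCoact.lTensor V.carrier
  let K : V.carrier ⊗[ℂ] (C ⊗[ℂ] A) →ₗ[ℂ] V.carrier ⊗[ℂ] (C ⊗[ℂ] A) :=
    ((D.rmul b).lTensor C).lTensor V.carrier
  have h0 : ∀ (x : V.carrier ⊗[ℂ] C) (a : A),
      TensorProduct.assoc ℂ V.carrier C A (x ⊗ₜ D.rmul b a) =
      K (TensorProduct.assoc ℂ V.carrier C A (x ⊗ₜ a)) := by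
    intro x a
    induction x with
    | zero => simp
    | add s₁ s₂ h₁ h₂ => simp only [map_add, TensorProduct.add_tmul, h₁, h₂]
    | tmul v c => rfl
  have hP : ∀ x, P (actRight V.carrier D.rmul b x) = K (P x) := by
    intro x
    induction x with
    | zero => simp
    | add x y hx hy => simp only [map_add, hx, hy]
    | tmul v a' => exact h0 (V.coact v) a'
  have hQ : ∀ x, Q (actRight V.carrier D.rmul b x) = K (Q x) := by
    intro x
    induction x with
    | zero => simp
    | add x y hx hy => simp only [map_add, hx, hy]
    | tmul v a' => exact congrArg (v ⊗ₜ[ℂ] ·) (D.leftCoact_mul_ι a' b.unop)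
  intro x hx
  have hx' : P x = Q x := hx
  change P (actRight V.carrier D.rmul b x) = Q (actRight V.carrier D.rmul b x)
  rw [hP, hQ, hx']

lemma DKMod.cotensor_coact (V : DKMod D.toDatum) :
    ∀ x ∈ V.cotensor, V.tensorA.coact x ∈ LinearMap.range (V.cotensor.subtype.rTensor A) := by
  let P := (TensorProduct.assoc ℂ V.carrier C A).toLinearMap ∘ₗ V.coact.rTensor A
  let Q := D.leftCoact.lTensor V.carrier
  have hker : V.cotensor = LinearMap.ker (P - Q) := LinearMap.eqLocus_eq_ker_sub P Q
  have hex : Function.Exact (V.cotensor.subtype.rTensor A) ((P - Q).rTensor A) := by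
    rw [hker]
    exact Module.Flat.rTensor_exact A (LinearMap.exact_subtype_ker_map _)
  let R : V.carrier ⊗[ℂ] (C ⊗[ℂ] A) →ₗ[ℂ] (V.carrier ⊗[ℂ] (C ⊗[ℂ] A)) ⊗[ℂ] A :=
    (TensorProduct.assoc ℂ V.carrier (C ⊗[ℂ] A) A).symm.toLinearMap ∘ₗ
      (coactRight C A).lTensor V.carrier
  let E : V.carrier ⊗[ℂ] (C ⊗[ℂ] (A ⊗[ℂ] A)) →ₗ[ℂ] (V.carrier ⊗[ℂ] (C ⊗[ℂ] A)) ⊗[ℂ] A :=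
    (TensorProduct.assoc ℂ V.carrier (C ⊗[ℂ] A) A).symm.toLinearMap ∘ₗ
      (TensorProduct.assoc ℂ C A A).symm.toLinearMap.lTensor V.carrier
  have h0 : ∀ (y : V.carrier ⊗[ℂ] C) (a a' : A),
      TensorProduct.assoc ℂ V.carrier C A (y ⊗ₜ a) ⊗ₜ a' =
      E (TensorProduct.assoc ℂ V.carrier C (A ⊗[ℂ] A) (y ⊗ₜ (a ⊗ₜ a'))) := by
    intro y a a'
    induction y with
    | zero => simp
    | add s₁ s₂ h₁ h₂ => simp only [map_add, TensorProduct.add_tmul, h₁, h₂]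
    | tmul v c => rfl
  have hP1 : ∀ (v : V.carrier) (s : A ⊗[ℂ] A),
      P.rTensor A ((TensorProduct.assoc ℂ V.carrier A A).symm (v ⊗ₜ s)) =
      E (TensorProduct.assoc ℂ V.carrier C (A ⊗[ℂ] A) (V.coact v ⊗ₜ s)) := by
    intro v s
    induction s with
    | zero => simp
    | add s₁ s₂ h₁ h₂ => simp only [map_add, TensorProduct.tmul_add, h₁, h₂]
    | tmul a a' => exact h0 (V.coact v) a a'
  have hP2 : ∀ (y : V.carrier ⊗[ℂ] C) (a : A), R (TensorProduct.assoc ℂ V.carrier C A (y ⊗ₜ a)) =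
      E (TensorProduct.assoc ℂ V.carrier C (A ⊗[ℂ] A) (y ⊗ₜ CoalgebraStruct.comul a)) := by
    intro y a
    induction y with
    | zero => simp
    | add s₁ s₂ h₁ h₂ => simp only [map_add, TensorProduct.add_tmul, h₁, h₂]
    | tmul v c => rfl
  have hP : ∀ x, P.rTensor A (coactRight V.carrier A x) = R (P x) := by
    intro x
    induction x with
    | zero => simp
    | add x y hx hy => simp only [map_add, hx, hy]
    | tmul v a => exact (hP1 v _).trans (hP2 _ a).symm
  have hQ1 : ∀ (v : V.carrier) (s : A ⊗[ℂ] A),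
      Q.rTensor A ((TensorProduct.assoc ℂ V.carrier A A).symm (v ⊗ₜ s)) =
      (TensorProduct.assoc ℂ V.carrier (C ⊗[ℂ] A) A).symm (v ⊗ₜ D.leftCoact.rTensor A s) := by
    intro v s
    induction s with
    | zero => simp
    | add s₁ s₂ h₁ h₂ => simp only [map_add, TensorProduct.tmul_add, h₁, h₂]
    | tmul a a' => rfl
  have hQ : ∀ x, Q.rTensor A (coactRight V.carrier A x) = R (Q x) := by
    intro x
    induction x with
    | zero => simp
    | add x y hx hy => simp only [map_add, hx, hy]
    | tmul v a =>
      refine (hQ1 v _).trans ?_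
      rw [D.rTensor_leftCoact_comul]
      rfl
  intro x hx
  have hx' : P x = Q x := hx
  refine (hex _).1 ?_
  change (P - Q).rTensor A (coactRight V.carrier A x) = 0
  rw [LinearMap.rTensor_sub, LinearMap.sub_apply, hP, hQ, hx', sub_self]

/-- The functor `F : _B Mod^C → _B Mod^A_B`, `V ↦ V □^C A`, on objects. The left `B`-module
structure is diagonal, the right `B`-module structure and the comodule structure are those
of `A`. -/
def DKMod.F (V : DKMod D.toDatum) : RelHopfBimod D.toDatum :=
  V.tensorA.sub V.cotensor V.cotensor_act V.cotensor_ract V.cotensor_coact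

/-- The corestriction `_B Mod^A → _B Mod^C` along `π`, with comodule structure
`m ↦ m₍₀₎ ⊗ π(m₍₁₎)`. -/
def DKMod.corestrict (M : DKMod D.toDatum.self) : DKMod D.toDatum where
  carrier := M.carrier
  act := M.act
  coact := D.π.toLinearMap.lTensor M.carrier ∘ₗ M.coact
  isCoaction := by
    constructor
    · intro v
      have h1 : ∀ x : M.carrier ⊗[ℂ] A, TensorProduct.assoc ℂ M.carrier C C
          ((D.π.toLinearMap.lTensor M.carrier ∘ₗ M.coact).rTensor C
            (D.π.toLinearMap.lTensor M.carrier x)) =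
          (TensorProduct.map D.π.toLinearMap D.π.toLinearMap).lTensor M.carrier
            (TensorProduct.assoc ℂ M.carrier A A (M.coact.rTensor A x)) := by
        intro x
        induction x with
        | zero => simp
        | add x y hx hy => simp only [map_add, hx, hy]
        | tmul m a =>
          simp only [LinearMap.lTensor_tmul, LinearMap.rTensor_tmul, LinearMap.comp_apply]
          generalize M.coact m = y
          induction y with
          | zero => simp
          | add x y hx hy => simp only [map_add, TensorProduct.add_tmul, hx, hy]
          | tmul m a => rfl
      have h2 : ∀ x : M.carrier ⊗[ℂ] A, (CoalgebraStruct.comul (R := ℂ)).lTensor M.carrier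
          (D.π.toLinearMap.lTensor M.carrier x) =
          (TensorProduct.map D.π.toLinearMap D.π.toLinearMap).lTensor M.carrier
            ((CoalgebraStruct.comul (R := ℂ)).lTensor M.carrier x) := by
        intro x
        induction x with
        | zero => simp
        | add x y hx hy => simp only [map_add, hx, hy]
        | tmul m a =>
          exact congrArg (m ⊗ₜ[ℂ] ·) (LinearMap.congr_fun D.π.map_comp_comul a).symm
      have h3 := congrArg
        ((TensorProduct.map D.π.toLinearMap D.π.toLinearMap).lTensor M.carrier)
        (M.isCoaction.coassoc v)
      rw [← h1, ← h2] at h3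
      exact h3
    · intro v
      have h1 : ∀ x : M.carrier ⊗[ℂ] A, (CoalgebraStruct.counit (R := ℂ)).lTensor M.carrier
          (D.π.toLinearMap.lTensor M.carrier x) =
          (CoalgebraStruct.counit (R := ℂ)).lTensor M.carrier x := by
        intro x
        induction x with
        | zero => simp
        | add x y hx hy => simp only [map_add, hx, hy]
        | tmul m a =>
          exact congrArg (m ⊗ₜ[ℂ] ·) (LinearMap.congr_fun D.π.counit_comp a)
      have h3 := M.isCoaction.counit v
      rw [← h1] at h3
      exact h3
  compat b v := by
    have h1 : ∀ (t : B ⊗[ℂ] A) (x : M.carrier ⊗[ℂ] A), D.π.toLinearMap.lTensor M.carrier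
        (tensorAct M.act.toLinearMap D.toDatum.self.mod.toLinearMap t x) =
        tensorAct M.act.toLinearMap D.mod.toLinearMap t
          (D.π.toLinearMap.lTensor M.carrier x) := by
      intro t x
      induction t with
      | zero => simp
      | add s₁ s₂ h₁ h₂ => simp only [map_add, LinearMap.add_apply, h₁, h₂]
      | tmul b a =>
        induction x with
        | zero => simp
        | add x y hx hy => simp only [map_add, hx, hy]
        | tmul m a' => exact congrArg (M.act b m ⊗ₜ[ℂ] ·) (D.π_mod a a')
    rw [LinearMap.comp_apply, M.compat]
    exact h1 _ _

/-- The subspace `M B₊` of `M ∈ _B Mod^A_B`. -/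
def RelHopfBimod.mulBPlus (M : RelHopfBimod D.toDatum) : Submodule ℂ M.carrier :=
  Submodule.span ℂ {x | ∃ (m : M.carrier) (b : B), CoalgebraStruct.counit (R := ℂ) (D.ι b) = 0 ∧
    x = M.ract (MulOpposite.op b) m}

lemma RelHopfBimod.mulBPlus_act (M : RelHopfBimod D.toDatum) (b : B) :
    M.mulBPlus ≤ M.mulBPlus.comap (M.act b) := by
  refine Submodule.span_le.2 ?_
  rintro _ ⟨m, b', hb', rfl⟩
  exact Submodule.subset_span ⟨M.act b m, b', hb', M.act_ract _ _ _⟩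

lemma RelHopfBimod.mulBPlus_coact (M : RelHopfBimod D.toDatum) :
    M.mulBPlus ≤ LinearMap.ker
      (M.mulBPlus.mkQ.rTensor C ∘ₗ (DKMod.corestrict M.toDKMod).coact) := by
  refine Submodule.span_le.2 ?_
  rintro _ ⟨m, b, hb, rfl⟩
  have h0 : ∀ (m : M.carrier) (b : B), M.mulBPlus.mkQ (M.ract (MulOpposite.op b) m) =
      CoalgebraStruct.counit (R := ℂ) (D.ι b) • M.mulBPlus.mkQ m := by
    intro m b
    rw [← map_smul]
    refine (Submodule.Quotient.eq _).2 (Submodule.subset_span ⟨m,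
      b - algebraMap ℂ B (CoalgebraStruct.counit (R := ℂ) (D.ι b)), ?_, ?_⟩)
    · simp [Algebra.algebraMap_eq_smul_one]
    · simp [Algebra.algebraMap_eq_smul_one]
  have h1 : ∀ (x : M.carrier ⊗[ℂ] A) (t : B ⊗[ℂ] A),
      M.mulBPlus.mkQ.rTensor C (D.π.toLinearMap.lTensor M.carrier (tensorRAct M.ract t x)) =
      (D.π.toLinearMap ∘ₗ LinearMap.mulRight ℂ (TensorProduct.lid ℂ A
        ((CoalgebraStruct.counit (R := ℂ) ∘ₗ D.ι.toAlgHom.toLinearMap).rTensor A t))).lTensor _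
        (M.mulBPlus.mkQ.rTensor A x) := by
    intro x t
    induction x with
    | zero => simp
    | add s₁ s₂ h₁ h₂ => simp only [map_add, h₁, h₂]
    | tmul m a =>
      induction t with
      | zero => simp
      | add s₁ s₂ h₁ h₂ =>
        simp only [map_add, mul_add, h₁, h₂, LinearMap.rTensor_tmul, LinearMap.lTensor_tmul,
          LinearMap.mulRight_apply, TensorProduct.tmul_add, LinearMap.add_apply,
          LinearMap.comp_apply]
      | tmul b a' =>
        simp only [tensorRAct_tmul, LinearMap.rTensor_tmul, LinearMap.lTensor_tmul, h0,
          LinearMap.comp_apply, LinearMap.mulRight_apply, TensorProduct.lid_tmul,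
          mul_smul_comm, map_smul, TensorProduct.smul_tmul]
        rfl
  have h2 : ∀ (x : M.carrier ⊗[ℂ] A),
      (D.π.toLinearMap ∘ₗ LinearMap.mulRight ℂ (D.ι b)).lTensor _
        (M.mulBPlus.mkQ.rTensor A x) = 0 := by
    intro x
    induction x with
    | zero => simp
    | add s₁ s₂ h₁ h₂ => simp only [map_add, h₁, h₂, add_zero]
    | tmul m a =>
      have h3 : D.π.toLinearMap (a * D.ι b) = 0 := by
        refine (D.π_mul_ι a b).trans ?_
        rw [hb, zero_smul]
      simp only [LinearMap.rTensor_tmul, LinearMap.lTensor_tmul, LinearMap.comp_apply,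
        LinearMap.mulRight_apply, h3, TensorProduct.tmul_zero]
  change M.mulBPlus.mkQ.rTensor C (D.π.toLinearMap.lTensor M.carrier
    (M.coact (M.ract (MulOpposite.op b) m))) = 0
  rw [M.compat_right, h1, D.lid_counit_α]
  exact h2 _

/-- The functor `G : _B Mod^A_B → _B Mod^C`, `M ↦ M / M B₊`, on objects. -/
def RelHopfBimod.G (M : RelHopfBimod D.toDatum) : DKMod D.toDatum :=
  (DKMod.corestrict M.toDKMod).quot M.mulBPlus M.mulBPlus_act M.mulBPlus_coact

/-- The tensor product `V ⊠ W = G(F(V) ⊗_B F(W))` on `_B Mod^C`. -/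
def DKMod.box (V W : DKMod D.toDatum) : DKMod D.toDatum :=
  (V.F.tensor W.F).G

/-! ## The Doi-Koppinen modules `B`, `C`, `A` and `B ⊙ C` -/

/-- `B ∈ _B Mod^A`, with left multiplication and the coaction `α`. -/
def CoidealDatum.BModA (D : CoidealDatum A B C) : DKMod D.toDatum.self where
  carrier := B
  act := Algebra.lmul ℂ B
  coact := D.α.toLinearMap
  isCoaction := D.isCoaction
  compat b b' := by
    have h : ∀ s t : B ⊗[ℂ] A, s * t =
        tensorAct (Algebra.lmul ℂ B).toLinearMap (Algebra.lmul ℂ A).toLinearMap s t := by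
      intro s t
      induction s with
      | zero => simp
      | add s₁ s₂ h₁ h₂ => simp only [map_add, LinearMap.add_apply, add_mul, h₁, h₂]
      | tmul a₁ a₂ =>
        induction t with
        | zero => simp
        | add s₁ s₂ h₁ h₂ => simp only [map_add, mul_add, h₁, h₂]
        | tmul a₃ a₄ =>
          rw [Algebra.TensorProduct.tmul_mul_tmul]
          rfl
    exact (map_mul D.α b b').trans (h _ _)

/-- `A ∈ _B Mod^A`, with left multiplication by `B` and the comultiplication. -/
def CoidealDatum.AModA (D : CoidealDatum A B C) : DKMod D.toDatum.self where
  carrier := A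
  act := (Algebra.lmul ℂ A).comp D.ι.toAlgHom
  coact := CoalgebraStruct.comul (R := ℂ)
  isCoaction := ⟨fun a => Coalgebra.coassoc_apply a, fun a => by simp⟩
  compat b a := by
    have h : ∀ (s : B ⊗[ℂ] A) (t : A ⊗[ℂ] A), D.ι.toAlgHom.toLinearMap.rTensor A s * t =
        tensorAct ((Algebra.lmul ℂ A).comp D.ι.toAlgHom).toLinearMap
          (Algebra.lmul ℂ A).toLinearMap s t := by
      intro s t
      induction s with
      | zero => simp
      | add s₁ s₂ h₁ h₂ => simp only [map_add, LinearMap.add_apply, add_mul, h₁, h₂]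
      | tmul a₁ a₂ =>
        induction t with
        | zero => simp
        | add s₁ s₂ h₁ h₂ => simp only [map_add, mul_add, h₁, h₂]
        | tmul a₃ a₄ =>
          rw [LinearMap.rTensor_tmul, Algebra.TensorProduct.tmul_mul_tmul]
          rfl
    refine (Bialgebra.comul_mul (R := ℂ) (D.ι b) a).trans ?_
    rw [D.ι_equivariant]
    exact h _ _

/-- The Doi-Koppinen module `B`: `b · b' = bb'` and `δ(b) = b₍₀₎ ⊗ π(b₍₁₎)`. -/
def CoidealDatum.BMod (D : CoidealDatum A B C) : DKMod D.toDatum :=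
  D.BModA.corestrict

/-- The Doi-Koppinen module `A`: `b · a = ba` and `δ(a) = a₍₁₎ ⊗ π(a₍₂₎)`. -/
def CoidealDatum.AMod (D : CoidealDatum A B C) : DKMod D.toDatum :=
  D.AModA.corestrict

lemma isCoaction_comul (C : Type*) [AddCommGroup C] [Module ℂ C] [Coalgebra ℂ C] :
    IsCoaction (CoalgebraStruct.comul (R := ℂ) (A := C)) :=
  ⟨fun c => Coalgebra.coassoc_apply c, fun c => by simp⟩

/-- The Doi-Koppinen module `C`: the `A`-module structure of `C` restricted to `B`, and
`δ = Δ_C`. -/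
def CoidealDatum.CMod (D : CoidealDatum A B C) : DKMod D.toDatum where
  carrier := C
  act := D.mod.comp D.ι.toAlgHom
  coact := CoalgebraStruct.comul (R := ℂ)
  isCoaction := isCoaction_comul C
  compat b c := by
    have h : ∀ (s : B ⊗[ℂ] A) (t : C ⊗[ℂ] C), tensorAct D.mod.toLinearMap D.mod.toLinearMap
        (D.ι.toAlgHom.toLinearMap.rTensor A s) t =
        tensorAct (D.mod.comp D.ι.toAlgHom).toLinearMap D.mod.toLinearMap s t := by
      intro s t
      induction s with
      | zero => simp
      | add s₁ s₂ h₁ h₂ => simp only [map_add, LinearMap.add_apply, h₁, h₂]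
      | tmul a₁ a₂ => rfl
    refine (D.comul_mod (D.ι b) c).trans ?_
    rw [D.ι_equivariant]
    exact h _ _

/-- The regular Doi-Koppinen module `B ⊙ C`, the `B`-induction of the comodule `(C, Δ_C)`:
`b · (b' ⊗ c) = bb' ⊗ c` and `δ(b ⊗ c) = b₍₀₎ ⊗ c₍₁₎ ⊗ b₍₁₎c₍₂₎`. -/
def CoidealDatum.regular (D : CoidealDatum A B C) : DKMod D.toDatum :=
  D.BModA.ind (CoalgebraStruct.comul (R := ℂ)) (isCoaction_comul C)

end Coideal

end DoiKoppinen

end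

/-! The bimodule `F(C)` is a copy of `A`: the map `a ↦ π(a₁) ⊗ a₂` is inverted by `ε ⊗ id`. The
bimodule `F(B)` should be a copy of `B ⊙ B`, through `b ⊗ b' ↦ b₀ ⊗ b₁b'`. Granting this, `C ⊠ B =
G(A ⊗_B (B ⊙ B)) = G(A ⊙ B) = A` and `B ⊠ C = G((B ⊙ B) ⊗_B A) = G(B ⊙ A) = B ⊙ C`, because `B / B₊
= ℂ` and `A / AB₊ = C`. The proof writes down the resulting maps `toCB` and `toBC`. Both have
explicit left inverses, built from counits and the antipode, so they are injective by pure Hopf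
algebra. Surjectivity needs only that the elements `b₀ ⊗ b₁b'` span `F(B)`
(`mem_span_of_mem_cotensor`).

That spanning statement is where the invariant state is used. Suppose `E : A → B` is a unital left
`B`-linear projection. Then `π(a) ⊗ x ↦ a₁ E(S(a₂)x)` is well defined on `C ⊗ A` and is a left
inverse of `a ↦ π(a₁) ⊗ a₂`. Applying it to the equation defining the cotensor product rewrites `z =
∑ b ⊗ a` in `B □^C A` as `∑ b₀ ⊗ b₁ E(S(b₂)a)`, a combination of the required form.

The projection `E` is orthogonal projection for the form `Φ(x* y)` (`exists_projection`). There is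
no completeness to supply it, so finite-dimensionality is used instead. Strong invariance makes
convolution by a functional `Φ(y ·)` an operator of finite rank on `B`, with an adjoint of the same
kind. For a given `a`, the element `y` can be chosen so that the adjoint fixes `a`; finding the
projection of `a` then becomes a finite-dimensional linear problem, solvable because `Φ` is
faithful. -/

noncomputable section

namespace DoiKoppinen

/-! ## Slice maps -/

section Slice

variable {A X : Type*} [AddCommGroup A] [Module ℂ A] [AddCommGroup X] [Module ℂ X]

/-- The slice map `x ⊗ a ↦ η(a) x`. -/
def sliceR (X : Type*) [AddCommGroup X] [Module ℂ X] (η : A →ₗ[ℂ] ℂ) : X ⊗[ℂ] A →ₗ[ℂ] X :=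
  (TensorProduct.rid ℂ X).toLinearMap ∘ₗ η.lTensor X

/-- The slice map `a ⊗ x ↦ η(a) x`. -/
def sliceL (X : Type*) [AddCommGroup X] [Module ℂ X] (η : A →ₗ[ℂ] ℂ) : A ⊗[ℂ] X →ₗ[ℂ] X :=
  (TensorProduct.lid ℂ X).toLinearMap ∘ₗ η.rTensor X

@[simp] lemma sliceR_tmul (η : A →ₗ[ℂ] ℂ) (x : X) (a : A) : sliceR X η (x ⊗ₜ a) = η a • x := by
  simp [sliceR]

@[simp] lemma sliceL_tmul (η : A →ₗ[ℂ] ℂ) (x : X) (a : A) : sliceL X η (a ⊗ₜ x) = η a • x := by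
  simp [sliceL]

/-- The left legs of a tensor span a finite-dimensional space. -/
lemma exists_fg_sliceR_mem (t : X ⊗[ℂ] A) :
    ∃ U : Submodule ℂ X, U.FG ∧ ∀ η : A →ₗ[ℂ] ℂ, sliceR X η t ∈ U := by
  induction t with
  | zero => exact ⟨⊥, Submodule.fg_bot, fun η => by simp⟩
  | tmul x a =>
    exact ⟨ℂ ∙ x, Submodule.fg_span_singleton x, fun η => by
      rw [sliceR_tmul]; exact Submodule.smul_mem _ _ (Submodule.mem_span_singleton_self x)⟩
  | add s t hs ht =>
    obtain ⟨U, hU, hs⟩ := hs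
    obtain ⟨V, hV, ht⟩ := ht
    exact ⟨U ⊔ V, hU.sup hV, fun η => by
      rw [map_add]
      exact add_mem (Submodule.mem_sup_left (hs η)) (Submodule.mem_sup_right (ht η))⟩

/-- The right legs of a tensor span a finite-dimensional space. -/
lemma exists_fg_sliceR_congr (t : X ⊗[ℂ] A) :
    ∃ U : Submodule ℂ A, U.FG ∧ ∀ η θ : A →ₗ[ℂ] ℂ, (∀ u ∈ U, η u = θ u) →
      sliceR X η t = sliceR X θ t := by
  induction t with
  | zero => exact ⟨⊥, Submodule.fg_bot, fun η θ _ => by simp⟩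
  | tmul x a =>
    exact ⟨ℂ ∙ a, Submodule.fg_span_singleton a, fun η θ h => by
      rw [sliceR_tmul, sliceR_tmul, h a (Submodule.mem_span_singleton_self a)]⟩
  | add s t hs ht =>
    obtain ⟨U, hU, hs⟩ := hs
    obtain ⟨V, hV, ht⟩ := ht
    exact ⟨U ⊔ V, hU.sup hV, fun η θ h => by
      rw [map_add, map_add, hs η θ fun u hu => h u (Submodule.mem_sup_left hu),
        ht η θ fun u hu => h u (Submodule.mem_sup_right hu)]⟩

/-- A linear map vanishing on `A ⊗ K` vanishes on each tensor with right legs in `K`. -/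
lemma eq_zero_of_sliceL_mem {Y : Type*} [AddCommGroup Y] [Module ℂ Y] (K : Submodule ℂ X)
    (G : A ⊗[ℂ] X →ₗ[ℂ] Y) (hG : ∀ a, ∀ x ∈ K, G (a ⊗ₜ x) = 0) (t : A ⊗[ℂ] X)
    (ht : ∀ μ : A →ₗ[ℂ] ℂ, sliceL X μ t ∈ K) : G t = 0 := by
  -- Expanded along a basis of `A`, the coefficients of `t` are its slices by the coordinate
  -- functionals, so they all lie in `K`.
  let b := Module.Basis.ofVectorSpace ℂ A
  obtain ⟨c, hc⟩ := TensorProduct.eq_repr_basis_left b t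
  have hcK : ∀ i, c i ∈ K := by
    intro i
    have h := ht (b.coord i)
    rw [← hc, Finsupp.sum, map_sum] at h
    classical
    simp only [sliceL_tmul, Module.Basis.coord_apply, Module.Basis.repr_self,
      Finsupp.single_apply, ite_smul, one_smul, zero_smul, Finset.sum_ite_eq',
      Finsupp.mem_support_iff] at h
    by_cases hi : c i = 0
    · rw [hi]; exact K.zero_mem
    · rwa [if_pos hi] at h
  rw [← hc, Finsupp.sum, map_sum]
  exact Finset.sum_eq_zero fun i _ => hG _ _ (hcK i)

/-- A family of functionals separating the points of a finite-dimensional space exhausts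
the dual space. -/
lemma surjective_of_separating {V : Type*} [AddCommGroup V] [Module ℂ V] [FiniteDimensional ℂ V]
    (T : X →ₗ[ℂ] Module.Dual ℂ V) (h : ∀ v, (∀ x, T x v = 0) → v = 0) :
    Function.Surjective T := by
  -- Since `V` is finite-dimensional, `T` is onto as soon as its transpose `V → X*` is injective,
  -- and that is the separation hypothesis.
  refine LinearMap.flip_injective_iff₂.1 ?_
  refine (injective_iff_map_eq_zero _).2 fun v hv => h v fun x => ?_
  exact LinearMap.congr_fun hv x

end Slice

/-! ## The invariant state -/

section Haar

variable {A : Type*} [Ring A] [HopfAlgebra ℂ A]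

local notation "S" => HopfAlgebra.antipode ℂ (A := A)
local notation "Δ" => CoalgebraStruct.comul (R := ℂ) (A := A)
local notation "ε" => CoalgebraStruct.counit (R := ℂ) (A := A)

lemma sliceL_counit_comul (a : A) : sliceL A ε (Δ a) = a := by
  simp [sliceL]

lemma sliceR_counit_comul (a : A) : sliceR A ε (Δ a) = a := by
  simp [sliceR]

/-- Strong right invariance: `x₍₁₎ Φ(y x₍₂₎) = S(y₍₁₎) Φ(y₍₂₎ x)`. -/
lemma sliceR_mulLeft_comul {Φ : A →ₗ[ℂ] ℂ} (hΦ : ∀ a, sliceR A Φ (Δ a) = Φ a • (1 : A))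
    (x y : A) : sliceR A (Φ ∘ₗ LinearMap.mulLeft ℂ y) (Δ x) =
      S (sliceR A (Φ ∘ₗ LinearMap.mulRight ℂ x) (Δ y)) := by
  -- On the iterated comultiplication of `y`, `F` gives `S(y₁) y₂x₁ Φ(y₃x₂)`. Reading `y₂x₁ ⊗ y₃x₂`
  -- as `Δ(y₂x)` and using invariance yields the right-hand side (`h1`); cancelling `S(y₁)y₂` yields
  -- the left-hand side (`h3`).
  let F : A ⊗[ℂ] (A ⊗[ℂ] A) →ₗ[ℂ] A := LinearMap.mul' ℂ A ∘ₗ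
    TensorProduct.map S (sliceR A Φ ∘ₗ LinearMap.mulRight ℂ (Δ x))
  have h1 : ∀ t : A ⊗[ℂ] A, F ((CoalgebraStruct.comul (R := ℂ)).lTensor A t) =
      S (sliceR A (Φ ∘ₗ LinearMap.mulRight ℂ x) t) := by
    intro t
    induction t with
    | zero => simp
    | add s t hs ht => simp only [map_add, hs, ht]
    | tmul u v => simp [F, ← Bialgebra.comul_mul, hΦ]
  have h2 : ∀ (r s : A ⊗[ℂ] A) (v : A), LinearMap.mul' ℂ A (TensorProduct.map S
      (sliceR A Φ ∘ₗ LinearMap.mulRight ℂ s) (TensorProduct.assoc ℂ A A A (r ⊗ₜ v))) =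
      LinearMap.mul' ℂ A ((S).rTensor A r) * sliceR A (Φ ∘ₗ LinearMap.mulLeft ℂ v) s := by
    intro r s v
    induction r with
    | zero => simp
    | add s t hs ht => simp only [map_add, TensorProduct.add_tmul, add_mul, hs, ht]
    | tmul u u' =>
      induction s with
      | zero => simp
      | add s t hs ht =>
        simp only [TensorProduct.assoc_tmul, TensorProduct.map_tmul, LinearMap.comp_apply,
          LinearMap.mulRight_apply, LinearMap.mul'_apply] at hs ht
        simp only [TensorProduct.assoc_tmul, TensorProduct.map_tmul, LinearMap.comp_apply,
          LinearMap.mulRight_apply, LinearMap.mul'_apply, map_add, mul_add, hs, ht]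
      | tmul a b => simp [mul_assoc]
  have h3 : ∀ t : A ⊗[ℂ] A, F (TensorProduct.assoc ℂ A A A
      ((CoalgebraStruct.comul (R := ℂ)).rTensor A t)) =
      sliceR A (Φ ∘ₗ LinearMap.mulLeft ℂ (sliceL A ε t)) (Δ x) := by
    intro t
    induction t with
    | zero => simp [sliceR]
    | add s t hs ht =>
      simp only [map_add, hs, ht]
      rw [← LinearMap.add_apply]
      congr 1
      ext u v
      simp [add_mul, add_smul]
    | tmul u v =>
      refine (h2 _ _ _).trans ?_
      rw [HopfAlgebra.mul_antipode_rTensor_comul_apply, ← Algebra.smul_def, ← LinearMap.smul_apply]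
      congr 1
      ext u v
      simp [smul_smul]
  rw [← h1, ← Coalgebra.coassoc_apply, h3, sliceL_counit_comul]

/-- Strong left invariance: `Φ(x₍₁₎ a) x₍₂₎ = Φ(x a₍₁₎) S(a₍₂₎)`. -/
lemma sliceL_mulRight_comul {Φ : A →ₗ[ℂ] ℂ} (hΦ : ∀ a, sliceL A Φ (Δ a) = Φ a • (1 : A))
    (x a : A) : sliceL A (Φ ∘ₗ LinearMap.mulRight ℂ a) (Δ x) =
      S (sliceL A (Φ ∘ₗ LinearMap.mulLeft ℂ x) (Δ a)) := by
  -- The mirror computation: `Φ(x₁a₁) x₂a₂ S(a₃)`, evaluated by invariance in `h1` and by cancelling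
  -- `a₂S(a₃)` in `h3`.
  let F : (A ⊗[ℂ] A) ⊗[ℂ] A →ₗ[ℂ] A := LinearMap.mul' ℂ A ∘ₗ
    TensorProduct.map (sliceL A Φ ∘ₗ LinearMap.mulLeft ℂ (Δ x)) S
  have h1 : ∀ t : A ⊗[ℂ] A, F ((CoalgebraStruct.comul (R := ℂ)).rTensor A t) =
      S (sliceL A (Φ ∘ₗ LinearMap.mulLeft ℂ x) t) := by
    intro t
    induction t with
    | zero => simp
    | add s t hs ht => simp only [map_add, hs, ht]
    | tmul u v => simp [F, ← Bialgebra.comul_mul, hΦ]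
  have h2 : ∀ (r s : A ⊗[ℂ] A) (u : A), LinearMap.mul' ℂ A (TensorProduct.map
      (sliceL A Φ ∘ₗ LinearMap.mulLeft ℂ s) S ((TensorProduct.assoc ℂ A A A).symm (u ⊗ₜ r))) =
      sliceL A (Φ ∘ₗ LinearMap.mulRight ℂ u) s * LinearMap.mul' ℂ A ((S).lTensor A r) := by
    intro r s u
    induction r with
    | zero => simp
    | add s t hs ht => simp only [map_add, TensorProduct.tmul_add, mul_add, hs, ht]
    | tmul v v' =>
      induction s with
      | zero => simp
      | add s t hs ht =>
        simp only [TensorProduct.assoc_symm_tmul, TensorProduct.map_tmul, LinearMap.comp_apply,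
          LinearMap.mulLeft_apply, LinearMap.mul'_apply] at hs ht
        simp only [TensorProduct.assoc_symm_tmul, TensorProduct.map_tmul, LinearMap.comp_apply,
          LinearMap.mulLeft_apply, LinearMap.mul'_apply, map_add, add_mul, hs, ht]
      | tmul a b => simp [mul_assoc]
  have h3 : ∀ t : A ⊗[ℂ] A, F ((TensorProduct.assoc ℂ A A A).symm
      ((CoalgebraStruct.comul (R := ℂ)).lTensor A t)) =
      sliceL A (Φ ∘ₗ LinearMap.mulRight ℂ (sliceR A ε t)) (Δ x) := by
    intro t
    induction t with
    | zero => simp [sliceL]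
    | add s t hs ht =>
      simp only [map_add, hs, ht]
      rw [← LinearMap.add_apply]
      congr 1
      ext u v
      simp [mul_add, add_smul]
    | tmul u v =>
      refine (h2 _ _ _).trans ?_
      rw [HopfAlgebra.mul_antipode_lTensor_comul_apply, ← Algebra.commutes, ← Algebra.smul_def,
        ← LinearMap.smul_apply]
      congr 1
      ext u v
      simp [smul_smul]
  rw [← h1, ← (LinearEquiv.symm_apply_eq _).2 (Coalgebra.coassoc_apply a).symm, h3,
    sliceR_counit_comul]

/-- Moving slices of the comultiplication through an invariant functional. -/
lemma map_sliceR_mul {Φ : A →ₗ[ℂ] ℂ} (hΦ : ∀ a, sliceL A Φ (Δ a) = Φ a • (1 : A))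
    (η : A →ₗ[ℂ] ℂ) (x a : A) :
    Φ (sliceR A η (Δ x) * a) = Φ (x * sliceR A (η ∘ₗ S) (Δ a)) := by
  have h1 : ∀ t : A ⊗[ℂ] A, Φ (sliceR A η t * a) =
      η (sliceL A (Φ ∘ₗ LinearMap.mulRight ℂ a) t) := by
    intro t
    induction t with
    | zero => simp
    | add s t hs ht => simp only [map_add, add_mul, hs, ht]
    | tmul a b => simp [mul_comm]
  have h2 : ∀ t : A ⊗[ℂ] A, Φ (x * sliceR A (η ∘ₗ S) t) =
      η (S (sliceL A (Φ ∘ₗ LinearMap.mulLeft ℂ x) t)) := by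
    intro t
    induction t with
    | zero => simp
    | add s t hs ht => simp only [map_add, mul_add, hs, ht]
    | tmul a b => simp [mul_comm]
  rw [h1, h2, sliceL_mulRight_comul hΦ]

/-- An invariant functional is nondegenerate. -/
lemma eq_zero_of_forall_mul {Φ : A →ₗ[ℂ] ℂ} (h1 : Φ 1 = 1)
    (hΦ : ∀ a, sliceR A Φ (Δ a) = Φ a • (1 : A)) (v : A) (hv : ∀ x, Φ (x * v) = 0) : v = 0 := by
  -- The radical `K` contains the right legs of `Δ(v)` for each `v ∈ K`: by strong invariance `v₁
  -- Φ(x v₂) = S(x₁) Φ(x₂ v) = 0`. Hence `0 = Φ(S(v₁)v₂) = ε(v)` on `K`, and then `v = v₁ ε(v₂) =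
  -- 0`. Positivity plays no role here.
  let K : Submodule ℂ A := LinearMap.ker ((LinearMap.mul ℂ A).flip.compr₂ Φ)
  have hK : ∀ v, v ∈ K ↔ ∀ x, Φ (x * v) = 0 := fun v =>
    ⟨fun h x => LinearMap.congr_fun h x, fun h => LinearMap.ext h⟩
  have hslice : ∀ v ∈ K, ∀ μ : A →ₗ[ℂ] ℂ, sliceL A μ (Δ v) ∈ K := by
    intro v hv μ
    refine (hK _).2 fun x => ?_
    have e : ∀ t : A ⊗[ℂ] A, Φ (x * sliceL A μ t) =
        μ (sliceR A (Φ ∘ₗ LinearMap.mulLeft ℂ x) t) := by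
      intro t
      induction t with
      | zero => simp
      | add s t hs ht => simp only [map_add, mul_add, hs, ht]
      | tmul a b => simp [mul_comm]
    have h0 : Φ ∘ₗ LinearMap.mulRight ℂ v = 0 := LinearMap.ext ((hK v).1 hv)
    rw [e, sliceR_mulLeft_comul hΦ, h0]
    simp [sliceR]
  have hε : ∀ v ∈ K, ε v = 0 := by
    intro v hv
    have := eq_zero_of_sliceL_mem K (Φ ∘ₗ LinearMap.mul' ℂ A ∘ₗ (S).rTensor A)
      (fun a x hx => by simpa using (hK x).1 hx (S a)) (Δ v) (hslice v hv)
    simpa [Algebra.algebraMap_eq_smul_one, h1] using this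
  have := eq_zero_of_sliceL_mem K (sliceR A ε) (fun a x hx => by simp [hε x hx]) (Δ v)
    (hslice v ((hK v).2 hv))
  rwa [sliceR_counit_comul] at this

/-- The map `u ⊗ v ↦ (x ↦ u E(S(v) x))`. -/
def antipodeTwist (E : A →ₗ[ℂ] A) : A ⊗[ℂ] A →ₗ[ℂ] Module.End ℂ A :=
  LinearMap.mul' ℂ (Module.End ℂ A) ∘ₗ TensorProduct.map (Algebra.lmul ℂ A).toLinearMap
    (LinearMap.mulLeft ℂ (E : Module.End ℂ A) ∘ₗ (Algebra.lmul ℂ A).toLinearMap ∘ₗ S)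

@[simp] lemma antipodeTwist_tmul (E : A →ₗ[ℂ] A) (u v x : A) :
    antipodeTwist E (u ⊗ₜ v) x = u * E (S v * x) := by
  simp [antipodeTwist]

variable [StarRing A] [StarModule ℂ A]

/-- The positive semidefinite sesquilinear form defined by a positive functional. -/
abbrev preInnerCore (Φ : A →ₗ[ℂ] ℂ) (hpos : ∀ a, 0 ≤ Φ (star a * a)) :
    PreInnerProductSpace.Core ℂ A where
  inner x y := Φ (star x * y)
  conj_inner_symm x y := by
    -- Hermitian symmetry by polarization: `Φ(a* a)` is real for `a = x`, `y`, `x + y` and `x + iy`.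
    have him : ∀ a, (Φ (star a * a)).im = 0 := fun a => ((Complex.le_def.1 (hpos a)).2).symm
    have e1 := him (x + y)
    have e2 := him (x + Complex.I • y)
    have ex := him x
    have ey := him y
    simp [add_mul, mul_add, ex, ey] at e1 e2
    apply Complex.ext
    · simp; linarith
    · simp; linarith
  re_inner_nonneg x := (Complex.le_def.1 (hpos x)).1
  add_left x y z := by simp [add_mul]
  smul_left x y r := by simp

/-- An invariant state is faithful. -/
lemma eq_zero_of_star_mul_self {Φ : A →ₗ[ℂ] ℂ} (h1 : Φ 1 = 1) (hpos : ∀ a, 0 ≤ Φ (star a * a))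
    (hΦ : ∀ a, sliceR A Φ (Δ a) = Φ a • (1 : A)) (a : A) (ha : Φ (star a * a) = 0) : a = 0 := by
  refine eq_zero_of_forall_mul h1 hΦ a fun x => ?_
  -- By Cauchy–Schwarz `Φ(a* a) = 0` forces `Φ(xa) = 0` for all `x`, so nondegeneracy applies.
  let c := preInnerCore Φ hpos
  have h := @InnerProductSpace.Core.inner_mul_inner_self_le ℂ A _ _ _ c (star x) a
  have h2 := @InnerProductSpace.Core.norm_inner_symm ℂ A _ _ _ c a (star x)
  have h3 : c.inner a a = 0 := ha
  have h4 : c.inner (star x) a = Φ (x * a) := by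
    change Φ (star (star x) * a) = _
    rw [star_star]
  rw [h2, h3, h4] at h
  simp only [map_zero, mul_zero] at h
  exact norm_eq_zero.1 (mul_self_eq_zero.1 (le_antisymm h (mul_self_nonneg _)))

end Haar

/-! ## The invariant expectation onto `B` -/

section Expectation

variable {A B C : Type*} [Ring A] [StarRing A] [HopfAlgebra ℂ A] [StarModule ℂ A]
  [Ring B] [StarRing B] [Algebra ℂ B] [StarModule ℂ B]
  [AddCommGroup C] [Module ℂ C] [Coalgebra ℂ C] (D : CoidealDatum A B C)

local notation "S" => HopfAlgebra.antipode ℂ (A := A)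
local notation "Δ" => CoalgebraStruct.comul (R := ℂ) (A := A)
local notation "ε" => CoalgebraStruct.counit (R := ℂ) (A := A)

/-- Since `Δ(B) ⊆ B ⊗ A`, the convolution operators `x ↦ x₁ η(x₂)` of `A` preserve `B`. -/
lemma CoidealDatum.ι_sliceR (η : A →ₗ[ℂ] ℂ) (b : B) :
    D.ι (sliceR B η (D.α b)) = sliceR A η (Δ (D.ι b)) := by
  have h : ∀ t : B ⊗[ℂ] A, D.ι (sliceR B η t) =
      sliceR A η (D.ι.toAlgHom.toLinearMap.rTensor A t) := by
    intro t
    induction t with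
    | zero => simp
    | add s t hs ht => simp only [map_add, hs, ht]
    | tmul a b => simp
  rw [h, ← D.ι_equivariant]

/-- Existence of the orthogonal projection of an element of `A` onto `B`. -/
lemma CoidealDatum.exists_projection {Φ : A →ₗ[ℂ] ℂ} (h1 : Φ 1 = 1)
    (hpos : ∀ a, 0 ≤ Φ (star a * a)) (hL : ∀ a, sliceL A Φ (Δ a) = Φ a • (1 : A))
    (hR : ∀ a, sliceR A Φ (Δ a) = Φ a • (1 : A)) (a : A) :
    ∃ p : B, ∀ b : B, Φ (D.ι b * D.ι p) = Φ (D.ι b * a) := by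
  obtain ⟨V, hV, hVa⟩ := exists_fg_sliceR_congr (Δ a)
  -- a functional `Φ(y ·)` which agrees with the counit on the image of `V` under the antipode
  obtain ⟨y, hy⟩ : ∃ y : A, ∀ v ∈ V, Φ (y * S v) = ε (S v) := by
    have : FiniteDimensional ℂ (V.map S) := Module.Finite.iff_fg.2 (hV.map _)
    obtain ⟨y, hy⟩ := surjective_of_separating
      ((LinearMap.mul ℂ A).compr₂ Φ |>.compl₂ (V.map S).subtype) (fun v hv =>
        Subtype.ext (eq_zero_of_forall_mul h1 hR v hv)) (ε ∘ₗ (V.map S).subtype)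
    exact ⟨y, fun v hv => LinearMap.congr_fun hy ⟨S v, Submodule.mem_map_of_mem hv⟩⟩
  let η : A →ₗ[ℂ] ℂ := Φ ∘ₗ LinearMap.mulLeft ℂ y
  -- `V` contains the right legs of `Δ(a)`, and `η ∘ S` agrees with `ε ∘ S = ε` on `V`.
  have hRa : sliceR A (η ∘ₗ S) (Δ a) = a := by
    rw [hVa (η ∘ₗ S) ε fun v hv => (hy v hv).trans (HopfAlgebra.counit_antipode v),
      sliceR_counit_comul]
  -- convolution by that functional is an operator of finite rank on `B`
  let L : B →ₗ[ℂ] B := sliceR B η ∘ₗ D.α.toLinearMap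
  have hLι : ∀ b, D.ι (L b) = sliceR A η (Δ (D.ι b)) := D.ι_sliceR η
  have hfin : FiniteDimensional ℂ (LinearMap.range L) := by
    obtain ⟨U, hU, hUy⟩ := exists_fg_sliceR_mem (Δ y)
    -- Strong invariance: `b₀ Φ(y b₁) = S(y₁) Φ(y₂ b)`, so the range lies in the image under `S` of
    -- the left legs of `Δ(y)`, whatever `b` is.
    have hle : (LinearMap.range L).map D.ι.toAlgHom.toLinearMap ≤ U.map S := by
      rintro _ ⟨_, ⟨b, rfl⟩, rfl⟩
      refine ⟨_, hUy (Φ ∘ₗ LinearMap.mulRight ℂ (D.ι b)), ?_⟩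
      rw [← sliceR_mulLeft_comul hR]
      exact (hLι b).symm
    have : FiniteDimensional ℂ (U.map S) := Module.Finite.iff_fg.2 (hU.map _)
    have h2 := Submodule.finiteDimensional_of_le hle
    exact Module.Finite.equiv (Submodule.equivMapOfInjective D.ι.toAlgHom.toLinearMap
      D.ι_injective (LinearMap.range L)).symm
  -- On the finite-dimensional range of `L`, the functional `w ↦ Φ(wa)` is represented by some `p ∈
  -- B`. Pairing `w` with `w*` shows that `B` separates the range, since `Φ` is faithful.
  obtain ⟨p, hp⟩ := surjective_of_separating
    (((LinearMap.mul ℂ A).flip.compr₂ Φ).compl₁₂ D.ι.toAlgHom.toLinearMap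
      (D.ι.toAlgHom.toLinearMap ∘ₗ (LinearMap.range L).subtype))
    (fun w hw => by
      have h2 : Φ (D.ι w * D.ι (star w)) = 0 := hw (star w)
      rw [map_star] at h2
      have h3 := eq_zero_of_star_mul_self h1 hpos hR (star (D.ι w)) (by rwa [star_star])
      refine Subtype.ext (D.ι_injective ?_)
      rw [star_eq_zero.1 h3]
      simp)
    ((LinearMap.mul ℂ A).flip.compr₂ Φ a ∘ₗ D.ι.toAlgHom.toLinearMap ∘ₗ
      (LinearMap.range L).subtype)
  have hp' : ∀ b, Φ (D.ι (L b) * D.ι p) = Φ (D.ι (L b) * a) := fun b =>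
    LinearMap.congr_fun hp ⟨L b, LinearMap.mem_range_self L b⟩
  -- Write `R(x) = x₁ η(S(x₂))`, which is adjoint to `L` by `map_sliceR_mul`. The witness is `R(p)`,
  -- because `Φ(b R(p)) = Φ(L(b) p) = Φ(L(b) a) = Φ(b R(a)) = Φ(ba)`.
  refine ⟨sliceR B (η ∘ₗ S) (D.α p), fun b => ?_⟩
  rw [D.ι_sliceR, ← map_sliceR_mul hL, ← hLι, hp', hLι, map_sliceR_mul hL, hRa]

/-- There is a unital `B`-linear projection of `A` onto `B`. -/
theorem CoidealDatum.exists_expectation [IsCQGHopfStarAlgebra A] :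
    ∃ E : A →ₗ[ℂ] B, E 1 = 1 ∧ ∀ b a, E (D.ι b * a) = b * E a := by
  obtain ⟨Φ, h1, hpos, hL, hR⟩ := IsCQGHopfStarAlgebra.exists_invariant_state (A := A)
  have hL' : ∀ a, sliceL A Φ (Δ a) = Φ a • (1 : A) := hL
  have hR' : ∀ a, sliceR A Φ (Δ a) = Φ a • (1 : A) := hR
  -- Testing against `b = (p - q)*` and using faithfulness shows that projections are unique.
  -- Linearity, unitality and `B`-linearity of `E` all follow from this.
  have huniq : ∀ p q : B, (∀ b, Φ (D.ι b * D.ι p) = Φ (D.ι b * D.ι q)) → p = q := by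
    intro p q h
    have h2 := h (star (p - q))
    rw [← sub_eq_zero, ← map_sub, ← mul_sub, ← map_sub, map_star] at h2
    have h3 := eq_zero_of_star_mul_self h1 hpos hR' _ h2
    exact sub_eq_zero.1 (D.ι_injective (h3.trans (map_zero D.ι).symm))
  choose E hE using D.exists_projection h1 hpos hL' hR'
  refine ⟨{ toFun := E, map_add' := fun x y => huniq _ _ fun b => ?_,
            map_smul' := fun r x => huniq _ _ fun b => ?_ },
    huniq _ _ fun b => ?_, fun b a => huniq _ _ fun b' => ?_⟩
  · simp only [hE, map_add, mul_add]
  · simp only [hE, map_smul, mul_smul_comm, RingHom.id_apply]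
  · simp only [LinearMap.coe_mk, AddHom.coe_mk, hE, map_one]
  · simp only [LinearMap.coe_mk, AddHom.coe_mk, hE, map_mul, ← mul_assoc]
    rw [← map_mul, hE]

end Expectation

/-! ## Generation of the cotensor product of `B` and `A` -/

section Generation

variable {A B C : Type*} [Ring A] [StarRing A] [HopfAlgebra ℂ A] [StarModule ℂ A]
  [Ring B] [StarRing B] [Algebra ℂ B] [StarModule ℂ B]
  [AddCommGroup C] [Module ℂ C] [Coalgebra ℂ C] (D : CoidealDatum A B C)

local notation "S" => HopfAlgebra.antipode ℂ (A := A)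
local notation "Δ" => CoalgebraStruct.comul (R := ℂ) (A := A)
local notation "ε" => CoalgebraStruct.counit (R := ℂ) (A := A)

/-- The factorization through `π` of a linear map vanishing on `A B₊`. -/
def CoidealDatum.liftπ {X : Type*} [AddCommGroup X] [Module ℂ X] (g : A →ₗ[ℂ] X)
    (h : ∀ a b, ε (D.ι b) = 0 → g (a * D.ι b) = 0) : C →ₗ[ℂ] X :=
  (LinearMap.ker D.π.toLinearMap).liftQ g (by
    rw [D.ker_π]
    refine Submodule.span_le.2 ?_
    rintro _ ⟨a, b, hb, rfl⟩
    exact h a b hb) ∘ₗ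
  (D.π.toLinearMap.quotKerEquivOfSurjective D.π_surjective).symm.toLinearMap

@[simp] lemma CoidealDatum.liftπ_π {X : Type*} [AddCommGroup X] [Module ℂ X] (g : A →ₗ[ℂ] X)
    (h : ∀ a b, ε (D.ι b) = 0 → g (a * D.ι b) = 0) (a : A) : D.liftπ g h (D.π a) = g a := by
  have h1 : (D.π.toLinearMap.quotKerEquivOfSurjective D.π_surjective).symm (D.π a) =
      (LinearMap.ker D.π.toLinearMap).mkQ a :=
    (LinearEquiv.symm_apply_eq _).2 rfl
  simp only [CoidealDatum.liftπ, LinearMap.comp_apply, LinearEquiv.coe_coe, h1]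
  rfl

/-- As `b₀ ∈ B`, it can be moved inside `E`: `a₁b₀ E(S(a₂b₁)x) = a₁ E(b₀S(b₁)S(a₂)x) = ε(b) a₁
E(S(a₂)x)`. This makes the twist vanish on `A B₊`, so that it descends to `C`. -/
lemma CoidealDatum.antipodeTwist_comul_mul_ι {E : A →ₗ[ℂ] B}
    (hE : ∀ b a, E (D.ι b * a) = b * E a) (a : A) (b : B) :
    antipodeTwist (D.ι.toAlgHom.toLinearMap ∘ₗ E) (Δ (a * D.ι b)) =
      ε (D.ι b) • antipodeTwist (D.ι.toAlgHom.toLinearMap ∘ₗ E) (Δ a) := by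
  have h : ∀ (s : A ⊗[ℂ] A) (t : B ⊗[ℂ] A) (r : ℂ),
      LinearMap.mul' ℂ A ((S).lTensor A (D.ι.toAlgHom.toLinearMap.rTensor A t)) =
        algebraMap ℂ A r →
      antipodeTwist (D.ι.toAlgHom.toLinearMap ∘ₗ E) (s * D.ι.toAlgHom.toLinearMap.rTensor A t) =
      r • antipodeTwist (D.ι.toAlgHom.toLinearMap ∘ₗ E) s := by
    intro s t r hr
    induction s with
    | zero => simp
    | add s s' hs hs' => simp only [map_add, add_mul, smul_add, hs, hs']
    | tmul u v =>
      ext x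
      have h1 : ∀ t : B ⊗[ℂ] A, antipodeTwist (D.ι.toAlgHom.toLinearMap ∘ₗ E)
          (u ⊗ₜ v * D.ι.toAlgHom.toLinearMap.rTensor A t) x =
          u * D.ι (E (LinearMap.mul' ℂ A
            ((S).lTensor A (D.ι.toAlgHom.toLinearMap.rTensor A t)) * (S v * x))) := by
        intro t
        induction t with
        | zero => simp
        | add s s' hs hs' => simp only [map_add, mul_add, add_mul, LinearMap.add_apply, hs, hs']
        | tmul b a => simp [HopfAlgebra.antipode_mul_antidistrib, hE, mul_assoc]
      rw [h1, hr]
      simp [Algebra.algebraMap_eq_smul_one]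
  rw [Bialgebra.comul_mul, D.ι_equivariant]
  refine h _ _ _ ?_
  rw [← D.ι_equivariant, HopfAlgebra.mul_antipode_lTensor_comul_apply]

/-- Each element of `B □^C A` is a combination of the elements `b₍₀₎ ⊗ b₍₁₎ b'`. -/
lemma CoidealDatum.mem_span_of_mem_cotensor [IsCQGHopfStarAlgebra A] (z : B ⊗[ℂ] A)
    (hz : z ∈ D.BMod.cotensor) :
    z ∈ Submodule.span ℂ {x | ∃ b b' : B, x = actRight B D.rmul (MulOpposite.op b') (D.α b)} := by
  obtain ⟨E, hE1, hE⟩ := D.exists_expectation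
  let E' : A →ₗ[ℂ] A := D.ι.toAlgHom.toLinearMap ∘ₗ E
  let N : C →ₗ[ℂ] Module.End ℂ A := D.liftπ (antipodeTwist E' ∘ₗ Δ) (fun a b hb => by
    rw [LinearMap.comp_apply, D.antipodeTwist_comul_mul_ι hE, hb, zero_smul])
  have hN : ∀ a, N (D.π a) = antipodeTwist E' (Δ a) := D.liftπ_π _ _
  let M : C ⊗[ℂ] A →ₗ[ℂ] A := TensorProduct.lift N
  -- The composite is `a₁ E(S(a₂)a₃) = a E(1) = a`.
  have hM : ∀ a, M (D.leftCoact a) = a := by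
    intro a
    let F : A ⊗[ℂ] (A ⊗[ℂ] A) →ₗ[ℂ] A := LinearMap.mul' ℂ A ∘ₗ
      (E' ∘ₗ LinearMap.mul' ℂ A ∘ₗ (S).rTensor A).lTensor A
    have h0 : ∀ (r : A ⊗[ℂ] A) (w : A),
        antipodeTwist E' r w = F (TensorProduct.assoc ℂ A A A (r ⊗ₜ w)) := by
      intro r w
      induction r with
      | zero => simp
      | add s s' hs hs' => simp only [map_add, TensorProduct.add_tmul, LinearMap.add_apply, hs, hs']
      | tmul u v => simp [F]
    have h1 : ∀ t : A ⊗[ℂ] A, M (D.π.toLinearMap.rTensor A t) =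
        F (TensorProduct.assoc ℂ A A A ((CoalgebraStruct.comul (R := ℂ)).rTensor A t)) := by
      intro t
      induction t with
      | zero => simp
      | add s s' hs hs' => simp only [map_add, hs, hs']
      | tmul u v => exact (LinearMap.congr_fun (hN u) v).trans (h0 _ _)
    have h2 : ∀ t : A ⊗[ℂ] A, F ((CoalgebraStruct.comul (R := ℂ)).lTensor A t) =
        sliceR A ε t := by
      intro t
      induction t with
      | zero => simp
      | add s s' hs hs' => simp only [map_add, hs, hs']
      | tmul u v => simp [F, E', Algebra.algebraMap_eq_smul_one, hE1]
    refine (h1 _).trans ?_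
    rw [Coalgebra.coassoc_apply, h2, sliceR_counit_comul]
  let δ : B →ₗ[ℂ] B ⊗[ℂ] C := D.π.toLinearMap.lTensor B ∘ₗ D.α.toLinearMap
  have hz' : TensorProduct.assoc ℂ B C A (δ.rTensor A z) = D.leftCoact.lTensor B z := hz
  have hMz : M.lTensor B (D.leftCoact.lTensor B z) = z := by
    rw [← LinearMap.comp_apply, ← LinearMap.lTensor_comp,
      show M ∘ₗ D.leftCoact = LinearMap.id from LinearMap.ext hM, LinearMap.lTensor_id,
      LinearMap.id_apply]
  rw [← hMz, ← hz']
  -- From here membership in the cotensor product is no longer needed: `b ⊗ a ↦ b₀ ⊗ b₁ E(S(b₂)a)`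
  -- sends all of `B ⊗ A` into the span.
  clear hMz hz' hz
  induction z with
  | zero => simp
  | add s s' hs hs' => simpa only [map_add] using add_mem hs hs'
  | tmul b a =>
    have h1 : ∀ t : B ⊗[ℂ] A, M.lTensor B (TensorProduct.assoc ℂ B C A
        (D.π.toLinearMap.lTensor B t ⊗ₜ a)) =
        (LinearMap.applyₗ a ∘ₗ antipodeTwist E').lTensor B
          ((CoalgebraStruct.comul (R := ℂ)).lTensor B t) := by
      intro t
      induction t with
      | zero => simp
      | add s s' hs hs' => simp only [map_add, TensorProduct.add_tmul, hs, hs']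
      | tmul b u => exact congrArg (b ⊗ₜ[ℂ] ·) (LinearMap.congr_fun (hN u) a)
    have h3 : ∀ (r : B ⊗[ℂ] A) (v : A), (LinearMap.applyₗ a ∘ₗ antipodeTwist E').lTensor B
        (TensorProduct.assoc ℂ B A A (r ⊗ₜ v)) =
        actRight B D.rmul (MulOpposite.op (E (S v * a))) r := by
      intro r v
      induction r with
      | zero => simp
      | add s s' hs hs' => simp only [map_add, TensorProduct.add_tmul, hs, hs']
      | tmul b u => simp [E']
    have h2 : ∀ t : B ⊗[ℂ] A, (LinearMap.applyₗ a ∘ₗ antipodeTwist E').lTensor B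
        (TensorProduct.assoc ℂ B A A (D.α.toLinearMap.rTensor A t)) ∈
        Submodule.span ℂ {x | ∃ b b' : B, x = actRight B D.rmul (MulOpposite.op b') (D.α b)} := by
      intro t
      induction t with
      | zero => simp
      | add s s' hs hs' => simpa only [map_add] using add_mem hs hs'
      | tmul b v => exact Submodule.subset_span ⟨b, E (S v * a), h3 _ _⟩
    have h4 := D.isCoaction.coassoc b
    rw [AlgHom.toLinearMap_apply] at h4
    rw [LinearMap.rTensor_tmul, LinearMap.comp_apply, AlgHom.toLinearMap_apply, h1, ← h4]
    exact h2 (D.α b)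

end Generation

section Box

variable {A B C : Type*} [Ring A] [StarRing A] [HopfAlgebra ℂ A] [StarModule ℂ A]
  [Ring B] [StarRing B] [Algebra ℂ B] [StarModule ℂ B]
  [AddCommGroup C] [Module ℂ C] [Coalgebra ℂ C] {D : CoidealDatum A B C}

local notation "Δ" => CoalgebraStruct.comul (R := ℂ) (A := A)
local notation "ε" => CoalgebraStruct.counit (R := ℂ) (A := A)

/-! ## Presentation of the box product -/

/-- Used to merge the two successive quotients `⊗_B` and `G` in the coaction of the box product; see
`box_coact_boxMk`. -/
lemma rTensor_lTensor_rTensor {M N P X Y : Type*} [AddCommGroup M] [Module ℂ M]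
    [AddCommGroup N] [Module ℂ N] [AddCommGroup P] [Module ℂ P] [AddCommGroup X] [Module ℂ X]
    [AddCommGroup Y] [Module ℂ Y] (f : M →ₗ[ℂ] N) (g : N →ₗ[ℂ] P) (p : X →ₗ[ℂ] Y)
    (t : M ⊗[ℂ] X) :
    g.rTensor Y (p.lTensor N (f.rTensor X t)) = TensorProduct.map (g ∘ₗ f) p t := by
  induction t with
  | zero => simp
  | add s s' hs hs' => simp only [map_add, hs, hs']
  | tmul x a => rfl

/-- The inclusion of `F(V)` in `V ⊗ A`. -/
def DKMod.inclF (V : DKMod D.toDatum) : V.F.carrier →ₗ[ℂ] V.carrier ⊗[ℂ] A :=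
  V.cotensor.subtype

lemma DKMod.inclF_injective (V : DKMod D.toDatum) : Function.Injective V.inclF :=
  V.cotensor.injective_subtype

lemma DKMod.rTensor_inclF_injective (V : DKMod D.toDatum) :
    Function.Injective (V.inclF.rTensor A) :=
  rTensor_subtype_injective V.cotensor A

lemma DKMod.rTensor_inclF_coact (V : DKMod D.toDatum) (x : V.F.carrier) :
    V.inclF.rTensor A (V.F.coact x) = coactRight V.carrier A (V.inclF x) :=
  rTensor_subCoact _ _ V.cotensor_coact x

/-- The projection of `F(V) ⊗ F(W)` onto `V ⊠ W`. -/
def DKMod.boxMk (V W : DKMod D.toDatum) :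
    V.F.carrier ⊗[ℂ] W.F.carrier →ₗ[ℂ] (V.box W).carrier :=
  (V.F.tensor W.F).mulBPlus.mkQ ∘ₗ (balancedKer V.F W.F).mkQ

lemma DKMod.boxMk_surjective (V W : DKMod D.toDatum) : Function.Surjective (V.boxMk W) :=
  (Submodule.mkQ_surjective _).comp (Submodule.mkQ_surjective _)

lemma DKMod.boxMk_balanced (V W : DKMod D.toDatum) (m : V.F.carrier) (b : B) (n : W.F.carrier) :
    V.boxMk W (V.F.ract (MulOpposite.op b) m ⊗ₜ n) = V.boxMk W (m ⊗ₜ W.F.act b n) :=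
  congrArg (V.F.tensor W.F).mulBPlus.mkQ
    ((Submodule.Quotient.eq _).2 (Submodule.subset_span ⟨m, b, n, rfl⟩))

lemma DKMod.boxMk_ract_eq_zero (V W : DKMod D.toDatum) (m : V.F.carrier) (b : B)
    (n : W.F.carrier) (hb : ε (D.ι b) = 0) :
    V.boxMk W (m ⊗ₜ W.F.ract (MulOpposite.op b) n) = 0 :=
  (Submodule.Quotient.mk_eq_zero _).2
    (Submodule.subset_span ⟨(balancedKer V.F W.F).mkQ (m ⊗ₜ n), b, hb, rfl⟩)

/-- The element `b - ε(b)1` lies in `B₊`, which `G` kills on the right. -/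
lemma DKMod.boxMk_ract (V W : DKMod D.toDatum) (m : V.F.carrier) (b : B) (n : W.F.carrier) :
    V.boxMk W (m ⊗ₜ W.F.ract (MulOpposite.op b) n) = ε (D.ι b) • V.boxMk W (m ⊗ₜ n) := by
  have h := V.boxMk_ract_eq_zero W m (b - algebraMap ℂ B (ε (D.ι b))) n
    (by simp [Algebra.algebraMap_eq_smul_one])
  have h2 : W.F.ract (MulOpposite.op (b - algebraMap ℂ B (ε (D.ι b)))) n =
      W.F.ract (MulOpposite.op b) n - ε (D.ι b) • n := by
    simp [Algebra.algebraMap_eq_smul_one]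
  rw [h2, TensorProduct.tmul_sub, TensorProduct.tmul_smul, map_sub, map_smul] at h
  exact sub_eq_zero.1 h

lemma DKMod.box_act_boxMk (V W : DKMod D.toDatum) (b : B) (m : V.F.carrier) (n : W.F.carrier) :
    (V.box W).act b (V.boxMk W (m ⊗ₜ n)) = V.boxMk W (V.F.act b m ⊗ₜ n) := rfl

lemma DKMod.box_coact_boxMk (V W : DKMod D.toDatum) (m : V.F.carrier) (n : W.F.carrier) :
    (V.box W).coact (V.boxMk W (m ⊗ₜ n)) = TensorProduct.map (V.boxMk W) D.π.toLinearMap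
      (mulCoact D.toDatum.self _ _ (V.F.coact m ⊗ₜ W.F.coact n)) := by
  have h : ∀ t : (V.F.carrier ⊗[ℂ] W.F.carrier) ⊗[ℂ] A,
      (V.F.tensor W.F).mulBPlus.mkQ.rTensor C (D.π.toLinearMap.lTensor _
        ((balancedKer V.F W.F).mkQ.rTensor A t)) =
      TensorProduct.map (V.boxMk W) D.π.toLinearMap t :=
    rTensor_lTensor_rTensor (balancedKer V.F W.F).mkQ (V.F.tensor W.F).mulBPlus.mkQ
      D.π.toLinearMap
  exact h _

/-- The map on `V ⊠ W` induced by a balanced map on `F(V) ⊗ F(W)` vanishing on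
`F(V) ⊗ F(W)B₊`. -/
def DKMod.boxLift (V W : DKMod D.toDatum) {X : Type*} [AddCommGroup X] [Module ℂ X]
    (f : V.F.carrier ⊗[ℂ] W.F.carrier →ₗ[ℂ] X)
    (h₁ : ∀ m b n, f (V.F.ract (MulOpposite.op b) m ⊗ₜ n) = f (m ⊗ₜ W.F.act b n))
    (h₂ : ∀ m b n, ε (D.ι b) = 0 → f (m ⊗ₜ W.F.ract (MulOpposite.op b) n) = 0) :
    (V.box W).carrier →ₗ[ℂ] X :=
  (V.F.tensor W.F).mulBPlus.liftQ
    ((balancedKer V.F W.F).liftQ f (by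
      refine Submodule.span_le.2 ?_
      rintro _ ⟨m, b, n, rfl⟩
      exact LinearMap.mem_ker.2 (by rw [map_sub, h₁, sub_self]))) (by
    refine Submodule.span_le.2 ?_
    rintro _ ⟨m, b, hb, rfl⟩
    obtain ⟨t, rfl⟩ := Submodule.mkQ_surjective (balancedKer V.F W.F) m
    change f (actRight V.F.carrier W.F.ract (MulOpposite.op b) t) = 0
    induction t with
    | zero => simp
    | add s s' hs hs' => rw [map_add, map_add, hs, hs', add_zero]
    | tmul m n => exact h₂ m b n hb)

lemma DKMod.boxLift_boxMk (V W : DKMod D.toDatum) {X : Type*} [AddCommGroup X] [Module ℂ X]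
    (f : V.F.carrier ⊗[ℂ] W.F.carrier →ₗ[ℂ] X)
    (h₁ : ∀ m b n, f (V.F.ract (MulOpposite.op b) m ⊗ₜ n) = f (m ⊗ₜ W.F.act b n))
    (h₂ : ∀ m b n, ε (D.ι b) = 0 → f (m ⊗ₜ W.F.ract (MulOpposite.op b) n) = 0)
    (t : V.F.carrier ⊗[ℂ] W.F.carrier) : V.boxLift W f h₁ h₂ (V.boxMk W t) = f t := rfl

/-! ## The bimodule `F(C)` -/

/-- Both sides of the cotensor equation are `π(a₁) ⊗ π(a₂) ⊗ a₃`, by coassociativity and because `π`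
is a coalgebra map. -/
lemma CoidealDatum.leftCoact_mem_cotensor (D : CoidealDatum A B C) (a : A) :
    D.leftCoact a ∈ D.CMod.cotensor := by
  have h1 : ∀ t : A ⊗[ℂ] A, TensorProduct.assoc ℂ C C A
      ((CoalgebraStruct.comul (R := ℂ) (A := C)).rTensor A (D.π.toLinearMap.rTensor A t)) =
      TensorProduct.map D.π.toLinearMap (D.π.toLinearMap.rTensor A)
        (TensorProduct.assoc ℂ A A A ((CoalgebraStruct.comul (R := ℂ)).rTensor A t)) := by
    intro t
    induction t with
    | zero => simp
    | add s s' hs hs' => simp only [map_add, hs, hs']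
    | tmul u v =>
      have h := LinearMap.congr_fun D.π.map_comp_comul u
      have h0 : CoalgebraStruct.comul (R := ℂ) (D.π.toLinearMap u) =
        TensorProduct.map D.π.toLinearMap D.π.toLinearMap (Δ u) := h.symm
      rw [LinearMap.rTensor_tmul, LinearMap.rTensor_tmul, LinearMap.rTensor_tmul, h0]
      generalize Δ u = r
      induction r with
      | zero => simp
      | add s s' hs hs' => simp only [map_add, TensorProduct.add_tmul, hs, hs']
      | tmul x y => rfl
  have h2 : ∀ t : A ⊗[ℂ] A, D.leftCoact.lTensor C (D.π.toLinearMap.rTensor A t) =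
      TensorProduct.map D.π.toLinearMap (D.π.toLinearMap.rTensor A)
        ((CoalgebraStruct.comul (R := ℂ)).lTensor A t) := by
    intro t
    induction t with
    | zero => simp
    | add s s' hs hs' => simp only [map_add, hs, hs']
    | tmul u v => rfl
  change TensorProduct.assoc ℂ C C A ((CoalgebraStruct.comul (R := ℂ) (A := C)).rTensor A
    (D.π.toLinearMap.rTensor A (Δ a))) = D.leftCoact.lTensor C (D.π.toLinearMap.rTensor A (Δ a))
  rw [h1, h2, Coalgebra.coassoc_apply]

variable (D) in
/-- The map `A → F(C)`, `a ↦ π(a₍₁₎) ⊗ a₍₂₎`. -/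
def CoidealDatum.toFC : A →ₗ[ℂ] D.CMod.F.carrier :=
  D.leftCoact.codRestrict D.CMod.cotensor D.leftCoact_mem_cotensor

lemma CoidealDatum.act_toFC (b : B) (a : A) :
    D.CMod.F.act b (D.toFC a) = D.toFC (D.ι b * a) := by
  apply Subtype.ext
  have h : ∀ (t : B ⊗[ℂ] A), tensorAct (D.mod.comp D.ι.toAlgHom).toLinearMap
      (Algebra.lmul ℂ A).toLinearMap t =
      tensorAct D.mod.toLinearMap (Algebra.lmul ℂ A).toLinearMap
        (D.ι.toAlgHom.toLinearMap.rTensor A t) := by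
    intro t
    induction t with
    | zero => simp
    | add s s' hs hs' => simp only [map_add, hs, hs']
    | tmul u v => rfl
  have h2 := D.leftCoact_mul (D.ι b) a
  rw [D.ι_equivariant, ← h] at h2
  exact h2.symm

lemma CoidealDatum.ract_toFC (b : B) (a : A) :
    D.CMod.F.ract (MulOpposite.op b) (D.toFC a) = D.toFC (a * D.ι b) :=
  Subtype.ext (D.leftCoact_mul_ι a b).symm

lemma CoidealDatum.coact_toFC (a : A) :
    D.CMod.F.coact (D.toFC a) = D.toFC.rTensor A (Δ a) := by
  apply D.CMod.rTensor_inclF_injective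
  rw [D.CMod.rTensor_inclF_coact, ← LinearMap.rTensor_comp_apply]
  exact (D.rTensor_leftCoact_comul a).symm

lemma CoidealDatum.sliceL_leftCoact (a : A) :
    sliceL A (CoalgebraStruct.counit (R := ℂ) (A := C)) (D.leftCoact a) = a := by
  have h : ∀ t : A ⊗[ℂ] A, sliceL A (CoalgebraStruct.counit (R := ℂ) (A := C))
      (D.π.toLinearMap.rTensor A t) = sliceL A ε t := by
    intro t
    induction t with
    | zero => simp
    | add s s' hs hs' => simp only [map_add, hs, hs']
    | tmul u v =>
      have h := LinearMap.congr_fun D.π.counit_comp u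
      rw [LinearMap.rTensor_tmul, sliceL_tmul, sliceL_tmul, ← h]
      rfl
  exact (h _).trans (sliceL_counit_comul a)

/-- Applying `ε_C` to the first leg of the cotensor equation for `z` leaves `z` on one side and the
image of `(ε_C ⊗ id)z` on the other. -/
lemma CoidealDatum.toFC_surjective : Function.Surjective D.toFC := by
  rintro ⟨z, hz⟩
  refine ⟨sliceL A (CoalgebraStruct.counit (R := ℂ) (A := C)) z, Subtype.ext ?_⟩
  have hz' : TensorProduct.assoc ℂ C C A
      ((CoalgebraStruct.comul (R := ℂ) (A := C)).rTensor A z) = D.leftCoact.lTensor C z := hz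
  have h1 : ∀ t : C ⊗[ℂ] A, sliceL (C ⊗[ℂ] A) (CoalgebraStruct.counit (R := ℂ) (A := C))
      (D.leftCoact.lTensor C t) =
      D.leftCoact (sliceL A (CoalgebraStruct.counit (R := ℂ) (A := C)) t) := by
    intro t
    induction t with
    | zero => simp
    | add s s' hs hs' => simp only [map_add, hs, hs']
    | tmul u v => simp
  have h2 : ∀ (r : C ⊗[ℂ] C) (a : A), sliceL (C ⊗[ℂ] A)
      (CoalgebraStruct.counit (R := ℂ) (A := C)) (TensorProduct.assoc ℂ C C A (r ⊗ₜ a)) =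
      sliceL C (CoalgebraStruct.counit (R := ℂ) (A := C)) r ⊗ₜ a := by
    intro r a
    induction r with
    | zero => simp
    | add s s' hs hs' => simp only [map_add, TensorProduct.add_tmul, hs, hs']
    | tmul u v => simp [TensorProduct.smul_tmul']
  have h3 : ∀ t : C ⊗[ℂ] A, sliceL (C ⊗[ℂ] A) (CoalgebraStruct.counit (R := ℂ) (A := C))
      (TensorProduct.assoc ℂ C C A
        ((CoalgebraStruct.comul (R := ℂ) (A := C)).rTensor A t)) = t := by
    intro t
    induction t with
    | zero => simp
    | add s s' hs hs' => simp only [map_add, hs, hs']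
    | tmul u v =>
      rw [LinearMap.rTensor_tmul, h2]
      simp [sliceL]
  exact (h1 z).symm.trans ((congrArg (sliceL (C ⊗[ℂ] A) _) hz').symm.trans (h3 z))

/-! ## The bimodule `F(B)` -/

variable (D) in
/-- The element `1 ⊗ 1` of `F(B)`. -/
def CoidealDatum.oneFB : D.BMod.F.carrier :=
  ⟨(1 : B) ⊗ₜ[ℂ] (1 : A), by
    change TensorProduct.assoc ℂ B C A (D.π.toLinearMap.lTensor B (D.α 1) ⊗ₜ 1) =
      (1 : B) ⊗ₜ[ℂ] (D.π.toLinearMap.rTensor A (Δ 1))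
    simp [Algebra.TensorProduct.one_def]⟩

/-- The left action on `F(B)` is diagonal, so the left submodule generated by `1 ⊗ 1` is `α(B)`. -/
lemma CoidealDatum.inclF_act_oneFB (b : B) :
    D.BMod.inclF (D.BMod.F.act b D.oneFB) = D.α b := by
  have h : ∀ t : B ⊗[ℂ] A, tensorAct (Algebra.lmul ℂ B).toLinearMap
      (Algebra.lmul ℂ A).toLinearMap t ((1 : B) ⊗ₜ[ℂ] (1 : A)) = t := by
    intro t
    induction t with
    | zero => simp
    | add s s' hs hs' => simp only [map_add, LinearMap.add_apply, hs, hs']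
    | tmul u v => simp
  exact h (D.α b)

lemma CoidealDatum.coact_oneFB : D.BMod.F.coact D.oneFB = D.oneFB ⊗ₜ[ℂ] (1 : A) := by
  apply D.BMod.rTensor_inclF_injective
  rw [D.BMod.rTensor_inclF_coact]
  change (TensorProduct.assoc ℂ B A A).symm ((1 : B) ⊗ₜ[ℂ] Δ 1) =
    ((1 : B) ⊗ₜ[ℂ] (1 : A)) ⊗ₜ[ℂ] (1 : A)
  simp [Algebra.TensorProduct.one_def]

/-- `F(B)` is generated as a bimodule by `1 ⊗ 1`. The two surjectivity proofs use the invariant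
state only through this fact. -/
lemma CoidealDatum.span_ract_act_oneFB [IsCQGHopfStarAlgebra A] :
    Submodule.span ℂ {x | ∃ b b' : B,
      x = D.BMod.F.ract (MulOpposite.op b') (D.BMod.F.act b D.oneFB)} = ⊤ := by
  refine eq_top_iff.2 fun z _ => ?_
  have h := D.mem_span_of_mem_cotensor (D.BMod.inclF z) z.2
  have h2 : {x | ∃ b b' : B, x = actRight B D.rmul (MulOpposite.op b') (D.α b)} =
      D.BMod.inclF '' {x | ∃ b b' : B,
        x = D.BMod.F.ract (MulOpposite.op b') (D.BMod.F.act b D.oneFB)} := by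
    ext x
    constructor
    · rintro ⟨b, b', rfl⟩
      exact ⟨_, ⟨b, b', rfl⟩, congrArg (actRight B D.rmul (MulOpposite.op b'))
        (D.inclF_act_oneFB b)⟩
    · rintro ⟨_, ⟨b, b', rfl⟩, rfl⟩
      exact ⟨b, b', congrArg (actRight B D.rmul (MulOpposite.op b')) (D.inclF_act_oneFB b)⟩
  rw [h2] at h
  replace h := (LinearMap.map_span D.BMod.inclF _).symm.le h
  obtain ⟨w, hw, hwz⟩ := h
  rwa [← D.BMod.inclF_injective hwz]

end Box

/-! ### Inverting the twist `b ⊗ c ↦ b₀ ⊗ b₁c` on the left. -/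

section Untwist

variable {A B C : Type*} [Ring A] [HopfAlgebra ℂ A] [Ring B] [Algebra ℂ B]
  [AddCommGroup C] [Module ℂ C] [Coalgebra ℂ C]

local notation "S" => HopfAlgebra.antipode ℂ (A := A)
local notation "ε" => CoalgebraStruct.counit (R := ℂ) (A := A)

/-- The map `(b ⊗ a) ⊗ c ↦ b ⊗ ac`. -/
def Datum.tensorMod (D : Datum A B C) : (B ⊗[ℂ] A) ⊗[ℂ] C →ₗ[ℂ] B ⊗[ℂ] C :=
  (TensorProduct.lift D.mod.toLinearMap).lTensor B ∘ₗ (TensorProduct.assoc ℂ B A C).toLinearMap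

@[simp] lemma Datum.tensorMod_tmul (D : Datum A B C) (b : B) (a : A) (c : C) :
    D.tensorMod ((b ⊗ₜ a) ⊗ₜ c) = b ⊗ₜ D.mod a c := rfl

/-- The map `b ⊗ c ↦ b₍₀₎ ⊗ S(b₍₁₎)c`. -/
def Datum.untwist (D : Datum A B C) : B ⊗[ℂ] C →ₗ[ℂ] B ⊗[ℂ] C :=
  D.tensorMod ∘ₗ ((S).lTensor B ∘ₗ D.α.toLinearMap).rTensor C

/-- By coassociativity the left-hand side is `b₀ ⊗ S(b₁)b₂c`, and the antipode cancels. -/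
lemma Datum.untwist_tensorMod_α (D : Datum A B C) (b : B) (c : C) :
    D.untwist (D.tensorMod (D.α b ⊗ₜ c)) = b ⊗ₜ c := by
  let Q : B ⊗[ℂ] (A ⊗[ℂ] A) →ₗ[ℂ] B ⊗[ℂ] C :=
    (LinearMap.applyₗ c ∘ₗ D.mod.toLinearMap ∘ₗ LinearMap.mul' ℂ A ∘ₗ (S).rTensor A).lTensor B
  have h1 : ∀ (r : B ⊗[ℂ] A) (u : A), D.tensorMod ((S).lTensor B r ⊗ₜ D.mod u c) =
      Q (TensorProduct.assoc ℂ B A A (r ⊗ₜ u)) := by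
    intro r u
    induction r with
    | zero => simp
    | add s s' hs hs' => simp only [map_add, TensorProduct.add_tmul, hs, hs']
    | tmul b v => simp [Q]
  have h2 : ∀ t : B ⊗[ℂ] A, D.untwist (D.tensorMod (t ⊗ₜ c)) =
      Q (TensorProduct.assoc ℂ B A A (D.α.toLinearMap.rTensor A t)) := by
    intro t
    induction t with
    | zero => simp
    | add s s' hs hs' => simp only [map_add, TensorProduct.add_tmul, hs, hs']
    | tmul b u => exact h1 _ _
  have h3 : ∀ t : B ⊗[ℂ] A, Q ((CoalgebraStruct.comul (R := ℂ)).lTensor B t) =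
      sliceR B ε t ⊗ₜ c := by
    intro t
    induction t with
    | zero => simp
    | add s s' hs hs' => simp only [map_add, TensorProduct.add_tmul, hs, hs']
    | tmul b u => simp [Q, Algebra.algebraMap_eq_smul_one, TensorProduct.smul_tmul']
  have h4 := D.isCoaction.coassoc b
  rw [AlgHom.toLinearMap_apply] at h4
  rw [h2, h4, h3]
  exact congrArg (· ⊗ₜ[ℂ] c) (D.isCoaction.counit b)

end Untwist

section Isomorphisms

variable {A B C : Type*} [Ring A] [StarRing A] [HopfAlgebra ℂ A] [StarModule ℂ A]
  [Ring B] [StarRing B] [Algebra ℂ B] [StarModule ℂ B]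
  [AddCommGroup C] [Module ℂ C] [Coalgebra ℂ C] (D : CoidealDatum A B C)

local notation "S" => HopfAlgebra.antipode ℂ (A := A)
local notation "Δ" => CoalgebraStruct.comul (R := ℂ) (A := A)
local notation "ε" => CoalgebraStruct.counit (R := ℂ) (A := A)
local notation "εC" => CoalgebraStruct.counit (R := ℂ) (A := C)

/-- A bijective morphism of Doi-Koppinen modules is an isomorphism. -/
def DKMod.Iso.ofBijective {D : Datum A B C} {V W : DKMod D} (f : V.carrier →ₗ[ℂ] W.carrier)
    (hf : Function.Bijective f) (hact : ∀ b v, f (V.act b v) = W.act b (f v))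
    (hcoact : ∀ v, W.coact (f v) = f.rTensor C (V.coact v)) : DKMod.Iso V W where
  toEquiv := LinearEquiv.ofBijective f hf
  map_act := hact
  map_coact := hcoact

/-! ## The counit maps `F(C) → A` and `F(B) → B` -/

/-- The map `F(C) → A`, `c ⊗ a ↦ ε(c) a`. -/
def CoidealDatum.ofFC : D.CMod.F.carrier →ₗ[ℂ] A := sliceL A εC ∘ₗ D.CMod.inclF

lemma CoidealDatum.ofFC_toFC (a : A) : D.ofFC (D.toFC a) = a := D.sliceL_leftCoact a

lemma CoidealDatum.ofFC_ract (b : B) (x : D.CMod.F.carrier) :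
    D.ofFC (D.CMod.F.ract (MulOpposite.op b) x) = D.ofFC x * D.ι b := by
  obtain ⟨a, rfl⟩ := D.toFC_surjective x
  rw [CoidealDatum.ract_toFC, ofFC_toFC, ofFC_toFC]

lemma CoidealDatum.ofFC_act (b : B) (x : D.CMod.F.carrier) :
    D.ofFC (D.CMod.F.act b x) = D.ι b * D.ofFC x := by
  obtain ⟨a, rfl⟩ := D.toFC_surjective x
  rw [CoidealDatum.act_toFC, ofFC_toFC, ofFC_toFC]

/-- The map `F(B) → B`, `b ⊗ a ↦ ε(a) b`. -/
def CoidealDatum.ofFB : D.BMod.F.carrier →ₗ[ℂ] B := sliceR B ε ∘ₗ D.BMod.inclF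

lemma CoidealDatum.sliceR_counit_α (b : B) : sliceR B ε (D.α b) = b := D.isCoaction.counit b

lemma CoidealDatum.ofFB_act (b : B) (x : D.BMod.F.carrier) :
    D.ofFB (D.BMod.F.act b x) = b * D.ofFB x := by
  have h : ∀ t x : B ⊗[ℂ] A, sliceR B ε (tensorAct (Algebra.lmul ℂ B).toLinearMap
      (Algebra.lmul ℂ A).toLinearMap t x) = sliceR B ε t * sliceR B ε x := by
    intro t x
    induction t with
    | zero => simp
    | add s s' hs hs' => simp only [map_add, add_mul, LinearMap.add_apply, hs, hs']
    | tmul b u =>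
      induction x with
      | zero => simp
      | add s s' hs hs' => simp only [map_add, mul_add, hs, hs']
      | tmul b' u' => simp [smul_smul, mul_comm]
  have h2 := h (D.α b) (D.BMod.inclF x)
  rw [D.sliceR_counit_α] at h2
  exact h2

/-- The right action only touches the leg in `A`, where `ε` is multiplicative. Hence `ofFB` kills
`F(B)B₊`, as a map out of `C ⊠ B` requires. -/
lemma CoidealDatum.ofFB_ract (b : B) (x : D.BMod.F.carrier) :
    D.ofFB (D.BMod.F.ract (MulOpposite.op b) x) = ε (D.ι b) • D.ofFB x := by
  have h : ∀ x : B ⊗[ℂ] A, sliceR B ε (actRight B D.rmul (MulOpposite.op b) x) =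
      ε (D.ι b) • sliceR B ε x := by
    intro x
    induction x with
    | zero => simp
    | add s s' hs hs' => simp only [map_add, smul_add, hs, hs']
    | tmul b' u' => simp [smul_smul, mul_comm]
  exact h _

lemma CoidealDatum.ofFB_oneFB : D.ofFB D.oneFB = 1 := by
  change sliceR B ε ((1 : B) ⊗ₜ[ℂ] (1 : A)) = 1
  simp

/-! ## The isomorphism of `A` and `C ⊠ B` -/

/-- The map `A → C ⊠ B` which sends `a` to the class of `(π(a₍₁₎) ⊗ a₍₂₎) ⊗ (1 ⊗ 1)`. -/
def CoidealDatum.toCB : A →ₗ[ℂ] (D.CMod.box D.BMod).carrier :=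
  D.CMod.boxMk D.BMod ∘ₗ (TensorProduct.mk ℂ _ _).flip D.oneFB ∘ₗ D.toFC

lemma CoidealDatum.toCB_apply (a : A) :
    D.toCB a = D.CMod.boxMk D.BMod (D.toFC a ⊗ₜ D.oneFB) := rfl

/-- A left inverse is induced by `m ⊗ n ↦ ofFC(m) ofFB(n)`, which is balanced because `ofFC` is
right `B`-linear and `ofFB` is left `B`-linear. -/
lemma CoidealDatum.toCB_injective : Function.Injective D.toCB := by
  let f : D.CMod.F.carrier ⊗[ℂ] D.BMod.F.carrier →ₗ[ℂ] A := LinearMap.mul' ℂ A ∘ₗ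
    TensorProduct.map D.ofFC (D.ι.toAlgHom.toLinearMap ∘ₗ D.ofFB)
  have hf : ∀ m n, f (m ⊗ₜ n) = D.ofFC m * D.ι (D.ofFB n) := fun m n => rfl
  refine Function.LeftInverse.injective (g := D.CMod.boxLift D.BMod f
    (fun m b n => by rw [hf, hf, D.ofFC_ract, D.ofFB_act, map_mul, mul_assoc])
    (fun m b n hb => by rw [hf, D.ofFB_ract, hb, zero_smul, map_zero, mul_zero])) fun a => ?_
  rw [toCB_apply, DKMod.boxLift_boxMk, hf, ofFC_toFC, ofFB_oneFB, map_one, mul_one]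

/-- On generators, `[toFC(a) ⊗ b(1 ⊗ 1)b'] = ε(b')[toFC(ab) ⊗ (1 ⊗ 1)]`: the factor `b'` leaves
through `G` and `b` moves across the balanced tensor product. -/
lemma CoidealDatum.toCB_surjective [IsCQGHopfStarAlgebra A] : Function.Surjective D.toCB := by
  intro x
  obtain ⟨t, rfl⟩ := D.CMod.boxMk_surjective D.BMod x
  change D.CMod.boxMk D.BMod t ∈ LinearMap.range D.toCB
  induction t with
  | zero => rw [map_zero]; exact zero_mem _
  | add s s' hs hs' => rw [map_add]; exact add_mem hs hs'
  | tmul m n =>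
    obtain ⟨a, rfl⟩ := D.toFC_surjective m
    have hn : n ∈ Submodule.span ℂ {x | ∃ b b' : B,
        x = D.BMod.F.ract (MulOpposite.op b') (D.BMod.F.act b D.oneFB)} := by
      rw [CoidealDatum.span_ract_act_oneFB]; exact Submodule.mem_top
    induction hn using Submodule.span_induction with
    | mem n hn =>
      obtain ⟨b, b', rfl⟩ := hn
      rw [DKMod.boxMk_ract, ← DKMod.boxMk_balanced, CoidealDatum.ract_toFC, ← D.toCB_apply]
      exact Submodule.smul_mem _ _ (LinearMap.mem_range_self _ _)
    | zero => rw [TensorProduct.tmul_zero, map_zero]; exact zero_mem _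
    | add x y _ _ hx hy => rw [TensorProduct.tmul_add, map_add]; exact add_mem hx hy
    | smul r x _ hx => rw [TensorProduct.tmul_smul, map_smul]; exact Submodule.smul_mem _ _ hx

lemma CoidealDatum.act_toCB (b : B) (a : A) :
    D.toCB (D.ι b * a) = (D.CMod.box D.BMod).act b (D.toCB a) := by
  rw [D.toCB_apply, D.toCB_apply, DKMod.box_act_boxMk, CoidealDatum.act_toFC]

/-- Since `1 ⊗ 1` is coinvariant, the diagonal coaction only sees the first factor, where `toFC` is
`A`-colinear. -/
lemma CoidealDatum.coact_toCB (a : A) : (D.CMod.box D.BMod).coact (D.toCB a) =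
    D.toCB.rTensor C (D.π.toLinearMap.lTensor A (Δ a)) := by
  have h : ∀ t : A ⊗[ℂ] A, TensorProduct.map (D.CMod.boxMk D.BMod) D.π.toLinearMap
      (mulCoact D.toDatum.self _ _ (D.toFC.rTensor A t ⊗ₜ (D.oneFB ⊗ₜ[ℂ] (1 : A)))) =
      D.toCB.rTensor C (D.π.toLinearMap.lTensor A t) := by
    intro t
    induction t with
    | zero => simp
    | add s s' hs hs' => simp only [map_add, TensorProduct.add_tmul, hs, hs']
    | tmul u v =>
      have h1 : D.toDatum.self.mod v 1 = v := mul_one v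
      rw [LinearMap.rTensor_tmul, mulCoact_tmul, TensorProduct.map_tmul, h1]
      rfl
  rw [toCB_apply, DKMod.box_coact_boxMk, CoidealDatum.coact_toFC, CoidealDatum.coact_oneFB, h]

/-- The Doi-Koppinen module `A` is isomorphic to `C ⊠ B`. -/
def CoidealDatum.isoCB [IsCQGHopfStarAlgebra A] : DKMod.Iso D.AMod (D.CMod.box D.BMod) :=
  DKMod.Iso.ofBijective (V := D.AMod) D.toCB ⟨D.toCB_injective, D.toCB_surjective⟩
    D.act_toCB D.coact_toCB

/-! ## The isomorphism of `B ⊙ C` and `B ⊠ C` -/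

/-- The map `B ⊙ C → B ⊠ C` which sends `b ⊗ π(a)` to the class of
`(b₍₀₎ ⊗ b₍₁₎) ⊗ (π(a₍₁₎) ⊗ a₍₂₎)`. -/
def CoidealDatum.toBC : B ⊗[ℂ] C →ₗ[ℂ] (D.BMod.box D.CMod).carrier :=
  TensorProduct.lift (D.liftπ
    (((TensorProduct.mk ℂ D.BMod.F.carrier D.CMod.F.carrier).compr₂ (D.BMod.boxMk D.CMod)).compl₁₂
      (LinearMap.applyₗ D.oneFB ∘ₗ D.BMod.F.act.toLinearMap) D.toFC).flip
    -- Well defined in `π(a)`: an element of `A B₊` is sent by `toFC` into `F(C)B₊`, which vanishes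
    -- in the box product.
    (fun a b hb => by
      ext b'
      change D.BMod.boxMk D.CMod (D.BMod.F.act b' D.oneFB ⊗ₜ D.toFC (a * D.ι b)) = 0
      rw [← CoidealDatum.ract_toFC]
      exact D.BMod.boxMk_ract_eq_zero _ _ _ _ hb)).flip

lemma CoidealDatum.toBC_tmul_π (b : B) (a : A) : D.toBC (b ⊗ₜ D.π a) =
    D.BMod.boxMk D.CMod (D.BMod.F.act b D.oneFB ⊗ₜ D.toFC a) := by
  rw [CoidealDatum.toBC, TensorProduct.lift.tmul, LinearMap.flip_apply, D.liftπ_π]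
  rfl

/-- A left inverse sends `(∑ b ⊗ u) ⊗ toFC(a)` to the untwist of `∑ b ⊗ uπ(a)`. On `α(b) ⊗ toFC(a)`
this is `b₀ ⊗ S(b₁)b₂π(a) = b ⊗ π(a)`. The map is balanced because `(ub)c = u(bc)` (`hact`). -/
lemma CoidealDatum.toBC_injective : Function.Injective D.toBC := by
  let j : D.BMod.F.carrier →ₗ[ℂ] B ⊗[ℂ] A := D.BMod.inclF
  have hj : ∀ b m, j (D.BMod.F.ract b m) = actRight B D.rmul b (j m) := fun _ _ => rfl
  let f : D.BMod.F.carrier ⊗[ℂ] D.CMod.F.carrier →ₗ[ℂ] B ⊗[ℂ] C :=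
    D.untwist ∘ₗ D.tensorMod ∘ₗ TensorProduct.map j (D.π.toLinearMap ∘ₗ D.ofFC)
  have hf : ∀ m n, f (m ⊗ₜ n) =
      D.untwist (D.tensorMod (j m ⊗ₜ D.π (D.ofFC n))) := fun m n => rfl
  have hact : ∀ (x : B ⊗[ℂ] A) (b : B) (c : C),
      D.tensorMod (actRight B D.rmul (MulOpposite.op b) x ⊗ₜ c) =
      D.tensorMod (x ⊗ₜ D.mod (D.ι b) c) := by
    intro x b c
    induction x with
    | zero => simp
    | add s s' hs hs' => simp only [map_add, TensorProduct.add_tmul, hs, hs']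
    | tmul b' u => simp
  refine Function.LeftInverse.injective (g := D.BMod.boxLift D.CMod f
    (fun m b n => ?_) (fun m b n hb => ?_)) fun x => ?_
  · rw [hf, hf, D.ofFC_act, D.π_mod, hj, hact]
  · rw [hf, D.ofFC_ract, D.π_mul_ι, hb, zero_smul, TensorProduct.tmul_zero, map_zero, map_zero]
  · induction x with
    | zero => simp only [map_zero]
    | add x y hx hy => simp only [map_add, hx, hy]
    | tmul b c =>
      obtain ⟨a, rfl⟩ := D.π_surjective c
      have hb : j (D.BMod.F.act b D.oneFB) = D.α b := CoidealDatum.inclF_act_oneFB b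
      rw [toBC_tmul_π, DKMod.boxLift_boxMk, hf, hb, ofFC_toFC, Datum.untwist_tensorMod_α]

/-- On generators `b'` crosses to the right factor: `[b(1 ⊗ 1)b' ⊗ toFC(a)] = [b(1 ⊗ 1) ⊗
toFC(b'a)]`, the image of `b ⊗ π(b'a)`. -/
lemma CoidealDatum.toBC_surjective [IsCQGHopfStarAlgebra A] : Function.Surjective D.toBC := by
  intro x
  obtain ⟨t, rfl⟩ := D.BMod.boxMk_surjective D.CMod x
  change D.BMod.boxMk D.CMod t ∈ LinearMap.range D.toBC
  induction t with
  | zero => rw [map_zero]; exact zero_mem _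
  | add s s' hs hs' => rw [map_add]; exact add_mem hs hs'
  | tmul m n =>
    obtain ⟨a, rfl⟩ := D.toFC_surjective n
    have hm : m ∈ Submodule.span ℂ {x | ∃ b b' : B,
        x = D.BMod.F.ract (MulOpposite.op b') (D.BMod.F.act b D.oneFB)} := by
      rw [CoidealDatum.span_ract_act_oneFB]; exact Submodule.mem_top
    induction hm using Submodule.span_induction with
    | mem m hm =>
      obtain ⟨b, b', rfl⟩ := hm
      rw [DKMod.boxMk_balanced, CoidealDatum.act_toFC, ← D.toBC_tmul_π]
      exact LinearMap.mem_range_self _ _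
    | zero => rw [TensorProduct.zero_tmul, map_zero]; exact zero_mem _
    | add x y _ _ hx hy => rw [TensorProduct.add_tmul, map_add]; exact add_mem hx hy
    | smul r x _ hx =>
      rw [← TensorProduct.smul_tmul', map_smul]; exact Submodule.smul_mem _ _ hx

lemma CoidealDatum.act_toBC (b : B) (x : B ⊗[ℂ] C) :
    D.toBC (actLeft (Algebra.lmul ℂ B) C b x) = (D.BMod.box D.CMod).act b (D.toBC x) := by
  induction x with
  | zero => simp only [map_zero]
  | add x y hx hy => simp only [map_add, hx, hy]
  | tmul b' c =>
    obtain ⟨a, rfl⟩ := D.π_surjective c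
    rw [actLeft_tmul, toBC_tmul_π, toBC_tmul_π, DKMod.box_act_boxMk, Algebra.coe_lmul_eq_mul,
      LinearMap.mul_apply', map_mul]
    rfl

/-- Compatibility of action and coaction, with coinvariance of `1 ⊗ 1`, gives `b₀(1 ⊗ 1) ⊗ b₁` for
the coaction of `b(1 ⊗ 1)`. What remains is `π(b₁a₂) = b₁π(a₂)`, checked in `h` with arbitrary
tensors in place of `α(b)` and `Δ(a)`. -/
lemma CoidealDatum.coact_toBC (x : B ⊗[ℂ] C) : (D.BMod.box D.CMod).coact (D.toBC x) =
    D.toBC.rTensor C (diagCoact D.toDatum D.α.toLinearMap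
      (CoalgebraStruct.comul (R := ℂ) (A := C)) x) := by
  have h : ∀ (t : B ⊗[ℂ] A) (s : A ⊗[ℂ] A),
      TensorProduct.map (D.BMod.boxMk D.CMod) D.π.toLinearMap (mulCoact D.toDatum.self _ _
        (tensorAct D.BMod.F.act.toLinearMap D.toDatum.self.mod.toLinearMap t
          (D.oneFB ⊗ₜ[ℂ] (1 : A)) ⊗ₜ D.toFC.rTensor A s)) =
      D.toBC.rTensor C (mulCoact D.toDatum B C
        (t ⊗ₜ TensorProduct.map D.π.toLinearMap D.π.toLinearMap s)) := by
    intro t s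
    induction t with
    | zero => simp
    | add s s' hs hs' =>
      simp only [map_add, LinearMap.add_apply, TensorProduct.add_tmul, hs, hs']
    | tmul b u =>
      induction s with
      | zero => simp
      | add s s' hs hs' => simp only [map_add, TensorProduct.tmul_add, hs, hs']
      | tmul x y =>
        have h1 : ∀ v w : A, D.toDatum.self.mod v w = v * w := fun _ _ => rfl
        have h2 : D.mod u (D.π.toLinearMap y) = D.π.toLinearMap (u * y) := (D.π_mod u y).symm
        simp only [tensorAct_tmul, LinearMap.rTensor_tmul, mulCoact_tmul, TensorProduct.map_tmul,
          AlgHom.toLinearMap_apply, h1, h2, mul_one]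
        exact congrArg (· ⊗ₜ[ℂ] D.π.toLinearMap (u * y)) (D.toBC_tmul_π b x).symm
  induction x with
  | zero => simp only [map_zero]
  | add x y hx hy => simp only [map_add, hx, hy]
  | tmul b c =>
    obtain ⟨a, rfl⟩ := D.π_surjective c
    have hπ : CoalgebraStruct.comul (R := ℂ) (D.π a) =
        TensorProduct.map D.π.toLinearMap D.π.toLinearMap (Δ a) :=
      (LinearMap.congr_fun D.π.map_comp_comul a).symm
    rw [toBC_tmul_π, DKMod.box_coact_boxMk, CoidealDatum.coact_toFC, D.BMod.F.compat,
      CoidealDatum.coact_oneFB, h, diagCoact, LinearMap.comp_apply, TensorProduct.map_tmul, hπ]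
    rfl

/-- The regular Doi-Koppinen module `B ⊙ C` is isomorphic to `B ⊠ C`. -/
def CoidealDatum.isoBC [IsCQGHopfStarAlgebra A] : DKMod.Iso D.regular (D.BMod.box D.CMod) :=
  DKMod.Iso.ofBijective (V := D.regular) D.toBC ⟨D.toBC_injective, D.toBC_surjective⟩
    D.act_toBC D.coact_toBC

end Isomorphisms

end DoiKoppinen

end

theorem proposition3p2 {A B C : Type*} [Ring A] [StarRing A] [HopfAlgebra ℂ A] [StarModule ℂ A]
    [IsCQGHopfStarAlgebra A] [Ring B] [StarRing B] [Algebra ℂ B] [StarModule ℂ B]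
    [AddCommGroup C] [Module ℂ C] [Coalgebra ℂ C] (D : DoiKoppinen.CoidealDatum A B C) :
    Nonempty (DoiKoppinen.DKMod.Iso D.regular (D.BMod.box D.CMod)) ∧
      Nonempty (DoiKoppinen.DKMod.Iso D.AMod (D.CMod.box D.BMod)) :=
  ⟨⟨D.isoBC⟩, ⟨D.isoCB⟩⟩
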